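/- Let $G$ be a linear graph: a directed graph with vertex set $\mathbb N=\{1,2,\dots\}$ whose edges are all pairs $(i,1)$ and $(i,i+1)$, $i\in\mathbb N$, together with some pairs $(i,j)$, $i<j-1$, only finitely many for each $i$. Assume that $G$ has bounded jumps: there is a constant $K$ such that $j-i<K$ for every edge $(i,j)$ with $i<j$. Let $\mathcal W$ be a function assigning to every edge a positive weight; the weight of a path is the product of the weights of its edges. For a subgraph $H\subset G$ and a vertex $v$, a simple $v$-cycle in $H$ is a path of length at least $1$ from $v$ to $v$ that does not go through $v$ in between. Let $q_{H,v}(k)$ be the sum of the weights of all simple $v$-cycles of length $k$ in $H$, put $\Phi_{H,v}(z)=\sum_{k\ge1}q_{H,v}(k)z^k$ for $z\ge0$, and let $R_v$ be the radius of convergence of $\Phi_{G,v}$. Assume that $(G,\mathcal W)$ is unstable positive, that is, $R_v>0$, $\Phi_{G,v}(R_v)=1$ and $\Phi_{G,v}'(R_v)<\infty$ for some vertex $v$. For a graph $H\subset G$ let $\Omega(H)$ be the set of the sequences $(\omega_i)_{i\in\mathbb Z}$ of vertices such that every $(\omega_i,\omega_{i+1})$ is an edge of $H$. An equilibrium measure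 of $(H,\mathcal W)$ is a shift invariant probability measure on $\Omega(H)$ that maximizes the functional $\mu\mapsto h(\mu)+\int\log\mathcal W(\omega_0,\omega_1)\,d\mu$ among all such measures, where $h$ is the entropy of the shift. Here, if $\log \mathcal W(\omega_0,\omega_1)$ is not $\mu$-integrable, the integral is understood as $\int[\log\mathcal W(\omega_0,\omega_1)+g(\omega_0)-g(\omega_1)]\,d\mu$ for any function $g$ on the vertex set that makes this integrand integrable (its value does not depend on $g$), and the functional is $-\infty$ if there is no such $g$. For $n\ge1$ let $G_n$ be the subgraph of $G$ generated by all simple $1$-cycles of length at most $n$, i.e. formed by the vertices and edges of these cycles. Then the sequence $(G_n)_{n\ge1}$ is an exhaustive sequence of finite subgraphs of $G$ (it increases, and its union is $G$) and it is regular relative to $\mathcal W$: $(G,\mathcal W)$ and all $(G_n,\mathcal W)$ have unique equilibrium measures $\mu$ and $\mu_n$, and, regarded as measures on $\Omega(G)$, the measures $\mu_n$ converge weakly to $\mu$ as $n\to\infty$. Moreover, with $\varphi=\Phi_{G,1}$, $R=R_1$, $\varphi_n=\Phi_{G_n,1}$, and $R_n>0$ the unique solution of $\varphi_n(R_n)=1$,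 one has $\varphi_n'(R_n)\to\varphi'(R)$ as $n\to\infty$. -/

import Mathlib

open MeasureTheory Filter Topology
open scoped NNReal ENNReal

namespace LoadedGraph

noncomputable section

/-! ### Simple cycles and their generating function

A directed graph is a `Digraph V`; a weight function is a map `W : V → V → ℝ≥0` of which only the
values on edges matter (they are required to be positive in the theorem). -/

variable {V : Type*}

/-- The simple `v`-cycles of length `n ≥ 1`, as vertex sequences `x 0, …, x n`: paths from `v` to
`v` that do not go through `v` in between. -/
def simpleCycles (G : Digraph V) (v : V) (n : ℕ) : Set (Fin (n + 1) → V) :=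
  {x | 1 ≤ n ∧ x 0 = v ∧ x (Fin.last n) = v ∧
    (∀ i : Fin n, G.Adj (x i.castSucc) (x i.succ)) ∧
    ∀ i : Fin (n + 1), i ≠ 0 → i ≠ Fin.last n → x i ≠ v}

/-- The weight of a path: the product of the weights of its edges. -/
def pathWeight (W : V → V → ℝ≥0) {n : ℕ} (x : Fin (n + 1) → V) : ℝ≥0 :=
  ∏ i : Fin n, W (x i.castSucc) (x i.succ)

/-- `q_v(n)`: the sum of the weights of all simple `v`-cycles of length `n`. -/
def cycleSum (G : Digraph V) (W : V → V → ℝ≥0) (v : V) (n : ℕ) : ℝ≥0∞ :=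
  ∑' x : simpleCycles G v n, (pathWeight W x.1 : ℝ≥0∞)

/-- The generating function `Φ(z) = ∑ q_v(n) z ^ n`, for `z ≥ 0`. -/
def genFun (G : Digraph V) (W : V → V → ℝ≥0) (v : V) (z : ℝ≥0∞) : ℝ≥0∞ :=
  ∑' n : ℕ, cycleSum G W v n * z ^ n

/-- The derivative `Φ'(z) = ∑ n q_v(n) z ^ (n - 1)`, for `z ≥ 0`. -/
def genFunDeriv (G : Digraph V) (W : V → V → ℝ≥0) (v : V) (z : ℝ≥0∞) : ℝ≥0∞ :=
  ∑' n : ℕ, ((n + 1 : ℕ) : ℝ≥0∞) * cycleSum G W v (n + 1) * z ^ n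

/-- The radius of convergence of the generating function. -/
def radius (G : Digraph V) (W : V → V → ℝ≥0) (v : V) : ℝ≥0∞ :=
  sSup {z : ℝ≥0∞ | genFun G W v z < ∞}

/-- Unstable positive loaded graphs: `Φ(R_v) = 1` and `Φ'(R_v) < ∞` for some vertex `v`. (The
first equation already forces `0 < R_v < ∞`.) -/
def IsUnstablePositive (G : Digraph V) (W : V → V → ℝ≥0) : Prop :=
  ∃ v : V, genFun G W v (radius G W v) = 1 ∧ genFunDeriv G W v (radius G W v) < ∞

/-- The subgraph generated by all simple `v`-cycles of length at most `n`. Its edges are the edges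
of these cycles, and its vertices are the endpoints of these edges. -/
def cycleSubgraph (G : Digraph V) (v : V) (n : ℕ) : Digraph V where
  Adj a b := ∃ l ≤ n, ∃ x ∈ simpleCycles G v l, ∃ i : Fin l, x i.castSucc = a ∧ x i.succ = b

/-- The graphs `H 0, H 1, …` form an exhaustive sequence of subgraphs of `G` (the vertices of
`H k` being the endpoints of its edges). -/
def IsExhaustive (G : Digraph V) (H : ℕ → Digraph V) : Prop :=
  (∀ k a b, (H k).Adj a b → G.Adj a b) ∧
  (∀ k a b, (H k).Adj a b → (H (k + 1)).Adj a b) ∧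
  (∀ a b, G.Adj a b → ∃ k, (H k).Adj a b) ∧
  (∀ a, ∃ k b, (H k).Adj a b ∨ (H k).Adj b a)

/-! ### Invariant measures and equilibrium measures

Measures on the path space `Ω(G)` are treated as measures on the space `ℤ → V` of all two-sided
sequences that are concentrated on the closed subset `Ω(G)`. In this way the measures of a graph
and of its subgraphs live on one space. -/

/-- The set `Ω(G)` of two-sided infinite paths. -/
def pathSpace (G : Digraph V) : Set (ℤ → V) :=
  {ω | ∀ i : ℤ, G.Adj (ω i) (ω (i + 1))}

/-- The left shift. -/
def shift (ω : ℤ → V) : ℤ → V := fun i => ω (i + 1)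

/-- The cylinder of all sequences that read `w` at the times `0, …, n - 1`. -/
def cylinder {n : ℕ} (w : Fin n → V) : Set (ℤ → V) :=
  {ω | ∀ i : Fin n, ω ((i : ℕ) : ℤ) = w i}

variable [MeasurableSpace V]

/-- The set `M(G)` of shift invariant probability measures on `Ω(G)`. -/
def invariantMeasures (G : Digraph V) : Set (ProbabilityMeasure (ℤ → V)) :=
  {μ | MeasurePreserving shift (μ : Measure (ℤ → V)) (μ : Measure (ℤ → V)) ∧
    ∀ᵐ ω ∂(μ : Measure (ℤ → V)), ω ∈ pathSpace G}

/-- The conditional entropy of the coordinate at time `n`, given the coordinates at the times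
`0, …, n - 1`: the sum, over the words `u = w a` of length `n + 1`, of
`μ[w a] * log (μ[w] / μ[w a])`. -/
def condEntropy (μ : Measure (ℤ → V)) (n : ℕ) : ℝ≥0∞ :=
  ∑' u : Fin (n + 1) → V, ENNReal.ofReal
    (μ.real (cylinder u) * Real.log (μ.real (cylinder (Fin.init u)) / μ.real (cylinder u)))

/-- The entropy of the shift with respect to the invariant measure `μ`: the limit (an infimum,
because the sequence is nonincreasing) of the conditional entropy of a coordinate given the `n`
preceding ones. On a path space with bounded out-degrees this is finite even if a single coordinate
has infinite entropy. -/
def entropy (μ : Measure (ℤ → V)) : ℝ≥0∞ :=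
  ⨅ n : ℕ, condEntropy μ n

/-- The functional `P(μ) = h(μ) + ∫ log W(ω₀, ω₁) dμ`. As `log W` need not be integrable, the
integral is taken after the addition of a coboundary `g(ω₀) - g(ω₁)` which makes the integrand
integrable. An integrable coboundary has integral zero with respect to an invariant measure, so
all admissible `g` give one value, and `g = 0` can be taken whenever `log W` is integrable. If no
`g` is admissible, the value is `-∞`. -/
def freeEnergy (W : V → V → ℝ≥0) (μ : Measure (ℤ → V)) : EReal :=
  ⨆ (g : V → ℝ)
    (_ : Integrable (fun ω : ℤ → V => Real.log (W (ω 0) (ω 1)) + g (ω 0) - g (ω 1)) μ),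
    (entropy μ : EReal) +
      ((∫ ω : ℤ → V, (Real.log (W (ω 0) (ω 1)) + g (ω 0) - g (ω 1)) ∂μ : ℝ) : EReal)

/-- An equilibrium measure of `(G, W)` is a shift invariant probability measure on `Ω(G)` at which
the functional `freeEnergy W` attains its maximum over all such measures. -/
def IsEquilibriumMeasure (G : Digraph V) (W : V → V → ℝ≥0)
    (μ : ProbabilityMeasure (ℤ → V)) : Prop :=
  μ ∈ invariantMeasures G ∧
    ∀ ν ∈ invariantMeasures G,
      freeEnergy W (ν : Measure (ℤ → V)) ≤ freeEnergy W (μ : Measure (ℤ → V))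

/-- The sequence `H` of finite subgraphs of `G` is regular relative to `W`: it is exhaustive, `G`
and the graphs `H k` have unique equilibrium measures, and the equilibrium measures of the `H k`
converge weakly to that of `G`. -/
def IsRegularSequence [TopologicalSpace V] [OpensMeasurableSpace (ℤ → V)]
    (G : Digraph V) (W : V → V → ℝ≥0) (H : ℕ → Digraph V) : Prop :=
  IsExhaustive G H ∧ (∀ k, {e : V × V | (H k).Adj e.1 e.2}.Finite) ∧
  (∃! μ, IsEquilibriumMeasure G W μ) ∧ (∀ k, ∃! μ, IsEquilibriumMeasure (H k) W μ) ∧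
  ∀ (μ : ProbabilityMeasure (ℤ → V)) (μs : ℕ → ProbabilityMeasure (ℤ → V)),
    IsEquilibriumMeasure G W μ → (∀ k, IsEquilibriumMeasure (H k) W (μs k)) →
    Tendsto μs atTop (𝓝 μ)

end

/-! ### Linear graphs -/

/-- All sets of positive integers are measurable. -/
instance instMeasurableSpacePNat : MeasurableSpace ℕ+ := ⊤

instance instDiscreteMeasurableSpacePNat : DiscreteMeasurableSpace ℕ+ := ⟨fun _ => trivial⟩

/-- Linear graphs on the positive integers: the edges are all `(i, 1)`, all `(i, i + 1)`, and some
forward jumps `(i, j)` with `i < j - 1`, finitely many for each `i`. -/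
structure IsLinear (G : Digraph ℕ+) : Prop where
  backward : ∀ i, G.Adj i 1
  step : ∀ i, G.Adj i (i + 1)
  edge : ∀ i j, G.Adj i j → j = 1 ∨ j = i + 1 ∨ i + 1 < j
  finite : ∀ i, {j | G.Adj i j ∧ i + 1 < j}.Finite

/-- The bounded jumps condition: `j - i < K` for all edges `(i, j)` with `i < j`. -/
def HasBoundedJumps (G : Digraph ℕ+) : Prop :=
  ∃ K : ℕ, ∀ i j : ℕ+, G.Adj i j → i < j → (j : ℕ) - (i : ℕ) < K

end LoadedGraph

namespace LoadedGraph

/-! A positive weight matrix `A` with a return series `Φ(R) = 1` carries, at the parameter `R`, a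
positive harmonic function (the generating functions of first passages to `v`) and an invariant
measure (the taboo generating functions out of `v`); their pairing is `R Φ'(R)`. If this is finite,
Doob's transform turns them into a stationary Markov measure. For an arbitrary invariant measure,
the expected `-log` of the transition probabilities dominates the conditional entropy by Gibbs'
inequality, with equality only if the measure is Markov with these transition probabilities, and it
differs from the expected `-log` of the weights by `log R` and a coboundary. So the free energy is
at most `-log R`, and the Markov measure is the only one to attain this value.

In a linear graph a path increases between two visits to `1`, so it passes every other vertex at
most once in between, and a decomposition of cycles at their passages through `1` moves the
assumption on `v` to the vertex `1`.
Bounded jumps confine the cycles of length at most `n` to the vertices up to `K n + 1`. As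
`Φ'(R) < ∞` makes the tail of `Φ` of smaller order than `1 / n`, the roots `R n` of the truncated
equations satisfy `(R n / R) ^ (K n + 1) → 1`, and replacing `R n` by `R` in polynomials of degree
at most `K n + 1` does not change their limits. -/

noncomputable section

/-! ### First passage sums -/

section Passage

variable {V : Type*}

open Classical in
/-- The weight matrix of a loaded graph, with entry `0` where there is no edge. -/
def edgeWeight (G : Digraph V) (W : V → V → ℝ≥0) (i j : V) : ℝ≥0∞ :=
  if G.Adj i j then (W i j : ℝ≥0∞) else 0

lemma adj_of_edgeWeight_ne_zero {G : Digraph V} {W : V → V → ℝ≥0} {i j : V}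
    (h : edgeWeight G W i j ≠ 0) : G.Adj i j :=
  by_contra fun hadj => h (if_neg hadj)

open Classical in
/-- The total weight of the paths of length `n + 1` from `i` to `v` that do not go through `v` in
between. Unlike simple cycles, these sums satisfy a recursion, since the starting point is free. -/
def firstHit (A : V → V → ℝ≥0∞) (v : V) : ℕ → V → ℝ≥0∞
  | 0, i => A i v
  | n + 1, i => ∑' j, if j = v then 0 else A i j * firstHit A v n j

open Classical in
/-- The total weight of the paths of length `n` from `v` to `j` that do not return to `v`. -/
def taboo (A : V → V → ℝ≥0∞) (v : V) : ℕ → V → ℝ≥0∞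
  | 0, j => if j = v then 1 else 0
  | n + 1, j => if j = v then 0 else ∑' i, taboo A v n i * A i j

/-- The generating function of the first passage sums; at `i = v` it is the function `Φ_v`. -/
def hitSum (A : V → V → ℝ≥0∞) (v : V) (z : ℝ≥0∞) (i : V) : ℝ≥0∞ :=
  ∑' n : ℕ, firstHit A v n i * z ^ (n + 1)

/-- The generating function of the first passage sums weighted by length, that is, `z` times the
derivative of `hitSum`. -/
def hitDeriv (A : V → V → ℝ≥0∞) (v : V) (z : ℝ≥0∞) (i : V) : ℝ≥0∞ :=
  ∑' n : ℕ, ((n + 1 : ℕ) : ℝ≥0∞) * (firstHit A v n i * z ^ (n + 1))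

/-- The generating function of the taboo sums. -/
def tabooSum (A : V → V → ℝ≥0∞) (v : V) (z : ℝ≥0∞) (j : V) : ℝ≥0∞ :=
  ∑' n : ℕ, taboo A v n j * z ^ n

/-- The words of length `n + 1` that read `v` at the end and nowhere else. They continue a starting
point to the paths counted by `firstHit`. -/
def passageWords (v : V) (n : ℕ) : Set (Fin (n + 1) → V) :=
  {y | ∀ k, y k = v ↔ k = Fin.last n}

lemma cons_mem_passageWords {v j : V} {n : ℕ} {y : Fin (n + 1) → V} :
    (Fin.cons j y : Fin (n + 2) → V) ∈ passageWords v (n + 1) ↔ j ≠ v ∧ y ∈ passageWords v n := by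
  simp [passageWords, Fin.forall_fin_succ (n := n + 1), ← Fin.succ_last, Fin.ext_iff]

lemma passageWords_zero (v : V) : passageWords v 0 = {![v]} := by
  ext y
  simp [passageWords, funext_iff]

lemma cons_mem_simpleCycles {G : Digraph V} {v i : V} {n : ℕ} {y : Fin (n + 1) → V} :
    (Fin.cons i y : Fin (n + 2) → V) ∈ simpleCycles G v (n + 1) ↔
      i = v ∧ y ∈ passageWords v n ∧
        ∀ k : Fin (n + 1), G.Adj ((Fin.cons i y : Fin (n + 2) → V) k.castSucc) (y k) := by
  have hwords : y ∈ passageWords v n ↔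
      y (Fin.last n) = v ∧ ∀ k, k ≠ Fin.last n → y k ≠ v :=
    ⟨fun h => ⟨(h _).mpr rfl, fun k hk hy => hk ((h k).mp hy)⟩,
      fun h k => ⟨fun hy => by_contra fun hk => h.2 k hk hy, fun hk => hk ▸ h.1⟩⟩
  simp only [simpleCycles, Set.mem_ofPred_eq, Fin.forall_fin_succ (n := n + 1), ← Fin.succ_last,
    Fin.cons_zero, Fin.cons_succ, hwords]
  simp only [le_add_iff_nonneg_left, zero_le, ne_eq, not_true_eq_false, IsEmpty.forall_iff,
    Fin.succ_ne_zero, not_false_eq_true, Fin.succ_inj, true_and, forall_const]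
  tauto

lemma tsum_fin_succ_pi {n : ℕ} (f : (Fin (n + 1) → V) → ℝ≥0∞) :
    ∑' x, f x = ∑' (i : V) (y : Fin n → V), f (Fin.cons i y) := by
  rw [← (Fin.consEquiv fun _ => V).tsum_eq, ENNReal.tsum_prod']
  rfl

lemma tsum_passageWords_prod (A : V → V → ℝ≥0∞) (v : V) (n : ℕ) (i : V) :
    ∑' y, (passageWords v n).indicator
      (fun y => ∏ k : Fin (n + 1), A ((Fin.cons i y : Fin (n + 2) → V) k.castSucc) (y k)) y =
      firstHit A v n i := by
  classical
  induction n generalizing i with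
  | zero =>
    rw [passageWords_zero, tsum_eq_single ![v] fun y hy => Set.indicator_of_notMem (by simpa) _]
    simp [firstHit]
  | succ n ih =>
    rw [tsum_fin_succ_pi, firstHit]
    refine tsum_congr fun j => ?_
    rw [← ih j]
    split_ifs with hj
    · simp [Set.indicator, cons_mem_passageWords, hj]
    · rw [← ENNReal.tsum_mul_left]
      refine tsum_congr fun y => ?_
      simp [Set.indicator_apply, cons_mem_passageWords, hj, Fin.prod_univ_succ (n := n + 1)]

lemma cycleSum_zero (G : Digraph V) (W : V → V → ℝ≥0) (v : V) : cycleSum G W v 0 = 0 := by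
  rw [cycleSum, ENNReal.tsum_eq_zero]
  rintro ⟨x, hx⟩
  exact absurd hx.1 (by simp)

lemma cycleSum_succ (G : Digraph V) (W : V → V → ℝ≥0) (v : V) (n : ℕ) :
    cycleSum G W v (n + 1) = firstHit (edgeWeight G W) v n v := by
  classical
  rw [← tsum_passageWords_prod, cycleSum,
    tsum_subtype (simpleCycles G v (n + 1)) fun x => (pathWeight W x : ℝ≥0∞), tsum_fin_succ_pi,
    tsum_eq_single v fun i hi => by simp [Set.indicator, cons_mem_simpleCycles, hi]]
  refine tsum_congr fun y => ?_
  by_cases hadj : ∀ k : Fin (n + 1), G.Adj ((Fin.cons v y : Fin (n + 2) → V) k.castSucc) (y k)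
  · simp [Set.indicator_apply, cons_mem_simpleCycles, hadj, pathWeight, edgeWeight]
  · rw [Set.indicator_of_notMem fun h => hadj (cons_mem_simpleCycles.mp h).2.2]
    push Not at hadj
    obtain ⟨k, hk⟩ := hadj
    refine (Set.indicator_apply_eq_zero.mpr fun _ => ?_).symm
    exact Finset.prod_eq_zero (Finset.mem_univ k) (if_neg hk)

lemma genFun_eq_hitSum (G : Digraph V) (W : V → V → ℝ≥0) (v : V) (z : ℝ≥0∞) :
    genFun G W v z = hitSum (edgeWeight G W) v z v := by
  rw [genFun, hitSum, tsum_eq_zero_add' ENNReal.summable]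
  simp [cycleSum_zero, cycleSum_succ]

lemma genFunDeriv_eq (G : Digraph V) (W : V → V → ℝ≥0) (v : V) (z : ℝ≥0∞) :
    genFunDeriv G W v z =
      ∑' n : ℕ, ((n + 1 : ℕ) : ℝ≥0∞) * firstHit (edgeWeight G W) v n v * z ^ n := by
  simp_rw [genFunDeriv, cycleSum_succ]

lemma mul_genFunDeriv (G : Digraph V) (W : V → V → ℝ≥0) (v : V) (z : ℝ≥0∞) :
    z * genFunDeriv G W v z = hitDeriv (edgeWeight G W) v z v := by
  rw [genFunDeriv_eq, hitDeriv, ← ENNReal.tsum_mul_left]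
  refine tsum_congr fun n => ?_
  ring

lemma tsum_tsum_eq_tsum_sum_antidiagonal (f : ℕ → ℕ → ℝ≥0∞) :
    ∑' (n : ℕ) (m : ℕ), f n m =
      ∑' k : ℕ, ∑ p ∈ Finset.HasAntidiagonal.antidiagonal k, f p.1 p.2 := by
  rw [← ENNReal.tsum_prod (f := f),
    ← Finset.HasAntidiagonal.sigmaAntidiagonalEquivProd.tsum_eq, ENNReal.tsum_sigma']
  refine tsum_congr fun k => ?_
  rw [tsum_fintype]
  exact Finset.sum_coe_sort (Finset.HasAntidiagonal.antidiagonal k) fun p => f p.1 p.2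

lemma tsum_tsum_add_eq_tsum_succ_mul (f : ℕ → ℝ≥0∞) :
    ∑' (n : ℕ) (m : ℕ), f (n + m) = ∑' k : ℕ, ((k + 1 : ℕ) : ℝ≥0∞) * f k := by
  rw [tsum_tsum_eq_tsum_sum_antidiagonal fun n m => f (n + m)]
  refine tsum_congr fun k => ?_
  rw [Finset.sum_congr rfl fun p hp => by rw [Finset.HasAntidiagonal.mem_antidiagonal.mp hp]]
  simp

variable (A : V → V → ℝ≥0∞) (v : V) (z : ℝ≥0∞)

lemma tsum_taboo_mul_firstHit (n m : ℕ) :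
    ∑' j, taboo A v n j * firstHit A v m j = firstHit A v (n + m) v := by
  classical
  induction n generalizing m with
  | zero => simp [taboo]
  | succ n ih =>
    rw [add_right_comm, add_assoc, ← ih (m + 1)]
    simp_rw [firstHit, ← ENNReal.tsum_mul_left]
    rw [ENNReal.tsum_comm]
    refine tsum_congr fun j => ?_
    rw [taboo]
    split_ifs
    · simp
    · rw [← ENNReal.tsum_mul_right]
      simp_rw [mul_assoc]

lemma tsum_tabooSum_mul_hitSum :
    ∑' j, tabooSum A v z j * hitSum A v z j = hitDeriv A v z v := by
  simp_rw [tabooSum, hitSum, ← ENNReal.tsum_mul_right, ← ENNReal.tsum_mul_left]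
  rw [ENNReal.tsum_comm, hitDeriv,
    ← tsum_tsum_add_eq_tsum_succ_mul fun k => firstHit A v k v * z ^ (k + 1)]
  refine tsum_congr fun n => ?_
  rw [ENNReal.tsum_comm]
  refine tsum_congr fun m => ?_
  rw [← tsum_taboo_mul_firstHit, ← ENNReal.tsum_mul_right]
  refine tsum_congr fun j => ?_
  ring

open Classical in
lemma hitSum_eq_add_tsum (i : V) :
    hitSum A v z i = z * A i v + ∑' j, if j = v then 0 else z * A i j * hitSum A v z j := by
  rw [hitSum, tsum_eq_zero_add' ENNReal.summable]
  congr 1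
  · simp [firstHit, mul_comm]
  · simp_rw [firstHit, ← ENNReal.tsum_mul_right]
    rw [ENNReal.tsum_comm]
    refine tsum_congr fun j => ?_
    split_ifs
    · simp
    · rw [hitSum, ← ENNReal.tsum_mul_left]
      refine tsum_congr fun n => ?_
      ring

variable {A v z}

lemma hitSum_eq_tsum_of_eq_one (h : hitSum A v z v = 1) (i : V) :
    hitSum A v z i = ∑' j, z * A i j * hitSum A v z j := by
  classical
  rw [hitSum_eq_add_tsum, ENNReal.tsum_eq_add_tsum_ite (f := fun j => z * A i j * hitSum A v z j) v,
    h, mul_one]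

variable (A v z) in
lemma tabooSum_self : tabooSum A v z v = 1 := by
  rw [tabooSum, tsum_eq_zero_add' ENNReal.summable]
  simp [taboo]

lemma tabooSum_eq_tsum_of_eq_one (h : hitSum A v z v = 1) (j : V) :
    tabooSum A v z j = ∑' i, tabooSum A v z i * (z * A i j) := by
  classical
  have hstep : ∑' i, tabooSum A v z i * (z * A i j) =
      ∑' n, (∑' i, taboo A v n i * A i j) * z ^ (n + 1) := by
    simp_rw [tabooSum, ← ENNReal.tsum_mul_right]
    rw [ENNReal.tsum_comm]
    refine tsum_congr fun n => tsum_congr fun i => ?_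
    ring
  rw [hstep]
  obtain rfl | hj := eq_or_ne j v
  · rw [tabooSum_self, ← h, hitSum]
    refine tsum_congr fun n => ?_
    congr 1
    exact (tsum_taboo_mul_firstHit A j n 0).symm
  · rw [tabooSum, tsum_eq_zero_add' ENNReal.summable]
    simp [taboo, hj]

end Passage

/-! ### Measures on two-sided sequences -/

section Sequences

variable {V : Type*}

/-- The cylinder of all sequences that agree with `w` at the times `a, …, b`. -/
def windowSet (a b : ℤ) (w : ℤ → V) : Set (ℤ → V) :=
  (Set.Icc a b).pi fun k => {w k}

/-- The cylinders over symmetric windows of length at least three. They form a π-system, and the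
windows are long enough to contain the origin even after a shift by one place. -/
def symmWindows (V : Type*) : Set (Set (ℤ → V)) :=
  {s | ∃ (m : ℕ) (w : ℤ → V), s = windowSet (-((m + 1 : ℕ) : ℤ)) (m + 1 : ℕ) w}

/-- The shift by `i` places. -/
def shiftBy (i : ℤ) (ω : ℤ → V) : ℤ → V := fun k => ω (k + i)

lemma mem_windowSet {a b : ℤ} {w ω : ℤ → V} :
    ω ∈ windowSet a b w ↔ ∀ k, a ≤ k → k ≤ b → ω k = w k := by
  simp [windowSet]

lemma preimage_shiftBy_windowSet (i a b : ℤ) (w : ℤ → V) :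
    shiftBy i ⁻¹' windowSet a b w = windowSet (a + i) (b + i) fun k => w (k - i) := by
  ext ω
  simp only [Set.mem_preimage, mem_windowSet, shiftBy]
  constructor
  · intro h k hak hkb
    simpa using h (k - i) (by omega) (by omega)
  · intro h k hak hkb
    simpa using h (k + i) (by omega) (by omega)

lemma cylinder_eq_windowSet (n : ℕ) (w : ℤ → V) :
    (cylinder fun k : Fin (n + 1) => w (k : ℕ)) = windowSet 0 n w := by
  ext ω
  rw [mem_windowSet]
  constructor
  · intro h k hk hkn
    lift k to ℕ using hk
    exact h ⟨k, by omega⟩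
  · exact fun h k => h (k : ℕ) (by omega) (by omega)

lemma exists_int_extension {n : ℕ} (w : Fin (n + 1) → V) :
    ∃ w' : ℤ → V, w = fun k : Fin (n + 1) => w' (k : ℕ) :=
  ⟨fun k => w (Fin.ofNat (n + 1) k.toNat), by simp⟩

lemma isPiSystem_symmWindows : IsPiSystem (symmWindows V) := by
  rintro _ ⟨m, w, rfl⟩ _ ⟨m', w', rfl⟩ ⟨x, hx, hx'⟩
  refine ⟨max m m', x, ?_⟩
  ext ω
  simp only [Set.mem_inter_iff, mem_windowSet] at hx hx' ⊢
  constructor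
  · rintro ⟨h, h'⟩ k hk hk'
    obtain hm | hm := le_total m m'
    · rw [h' k (by grind) (by grind), hx' k (by grind) (by grind)]
    · rw [h k (by grind) (by grind), hx k (by grind) (by grind)]
  · exact fun h => ⟨fun k hk hk' => by rw [h k (by grind) (by grind), hx k hk hk'],
      fun k hk hk' => by rw [h k (by grind) (by grind), hx' k hk hk']⟩

lemma exists_symmWindow_subset [TopologicalSpace V] [DiscreteTopology V] {u : Set (ℤ → V)}
    (hu : IsOpen u) {x : ℤ → V} (hx : x ∈ u) : ∃ s ∈ symmWindows V, s ∈ 𝓝 x ∧ s ⊆ u := by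
  obtain ⟨I, t, ht, hsub⟩ := isOpen_pi_iff.mp hu x hx
  refine ⟨_, ⟨I.sup Int.natAbs, x, rfl⟩, ?_, fun ω hω => hsub fun k hk => ?_⟩
  · exact (isOpen_set_pi (Set.finite_Icc _ _) fun _ _ => isOpen_discrete _).mem_nhds
      (mem_windowSet.mpr fun _ _ _ => rfl)
  · have hle : k.natAbs ≤ I.sup Int.natAbs := Finset.le_sup (f := Int.natAbs) hk
    rw [mem_windowSet.mp hω k (by omega) (by omega)]
    exact (ht k hk).2

variable [MeasurableSpace V]

lemma measurable_shiftBy (i : ℤ) : Measurable (shiftBy i : (ℤ → V) → ℤ → V) :=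
  measurable_pi_lambda _ fun _ => measurable_pi_apply _

/-- The shift as a measurable equivalence. -/
def shiftEquiv (V : Type*) [MeasurableSpace V] : (ℤ → V) ≃ᵐ (ℤ → V) where
  toFun := shift
  invFun := shiftBy (-1)
  left_inv ω := by funext k; simp [shift, shiftBy]
  right_inv ω := by funext k; simp [shift, shiftBy]
  measurable_toFun := measurable_shiftBy 1
  measurable_invFun := measurable_shiftBy (-1)

lemma measurePreserving_shiftBy {μ : Measure (ℤ → V)} (h : MeasurePreserving shift μ μ) (i : ℤ) :
    MeasurePreserving (shiftBy i) μ μ := by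
  have hinv : MeasurePreserving (shiftBy (-1)) μ μ := MeasurePreserving.symm (shiftEquiv V) h
  induction i with
  | zero =>
    convert! MeasurePreserving.id μ using 1
    funext ω k
    simp [shiftBy]
  | succ n ih =>
    convert! ih.comp h using 1
    funext ω k
    simp only [shiftBy, Function.comp_apply, shift, add_assoc]
  | pred n ih =>
    convert! ih.comp hinv using 1
    funext ω k
    simp only [shiftBy, Function.comp_apply]
    congr 1
    ring

variable [DiscreteMeasurableSpace V]

lemma measurableSet_windowSet (a b : ℤ) (w : ℤ → V) : MeasurableSet (windowSet a b w) :=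
  MeasurableSet.pi (Set.to_countable _) fun _ _ => MeasurableSet.of_discrete

lemma measurableSet_cylinder {n : ℕ} (w : Fin n → V) : MeasurableSet (cylinder w) := by
  have heq : cylinder w = ⋂ k : Fin n, (fun ω : ℤ → V => ω (k : ℕ)) ⁻¹' {w k} := by
    ext ω
    simp [cylinder]
  rw [heq]
  exact MeasurableSet.iInter fun k => measurable_pi_apply _ MeasurableSet.of_discrete

lemma measure_windowSet_eq_cylinder {μ : Measure (ℤ → V)} (h : MeasurePreserving shift μ μ)
    (a : ℤ) (n : ℕ) (w : ℤ → V) :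
    μ (windowSet a (a + n) w) = μ (cylinder fun k : Fin (n + 1) => w (a + (k : ℕ))) := by
  rw [← (measurePreserving_shiftBy h a).measure_preimage
    (measurableSet_cylinder _).nullMeasurableSet, cylinder_eq_windowSet n fun k => w (a + k),
    preimage_shiftBy_windowSet]
  simp [add_comm a]

lemma measure_symmWindow_eq_cylinder {μ : Measure (ℤ → V)} (h : MeasurePreserving shift μ μ)
    (m : ℕ) (w : ℤ → V) :
    μ (windowSet (-(m : ℤ)) m w) = μ (cylinder fun k : Fin (2 * m + 1) => w (-m + (k : ℕ))) := by
  rw [← measure_windowSet_eq_cylinder h]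
  congr 2
  push_cast
  ring

variable [Countable V]

lemma pi_eq_generateFrom_symmWindows :
    (MeasurableSpace.pi : MeasurableSpace (ℤ → V)) =
      MeasurableSpace.generateFrom (symmWindows V) := by
  apply le_antisymm
  · refine iSup_le fun k => measurable_iff_comap_le.mp ?_
    let I : Set ℤ := Set.Icc (-((k.natAbs + 1 : ℕ) : ℤ)) (k.natAbs + 1 : ℕ)
    have hkI : k ∈ I := ⟨by omega, by omega⟩
    have hrestrict : Measurable[MeasurableSpace.generateFrom (symmWindows V), ⊤]
        fun (ω : ℤ → V) (j : I) => ω j := by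
      refine @measurable_to_countable' _ _ ⊤ _ (MeasurableSpace.generateFrom (symmWindows V)) _ ?_
      intro u
      obtain h | ⟨ω₀, rfl⟩ :=
        ((fun (ω : ℤ → V) (j : I) => ω j) ⁻¹' {u}).eq_empty_or_nonempty
      · rw [h]
        exact @MeasurableSet.empty _ (MeasurableSpace.generateFrom (symmWindows V))
      · refine MeasurableSpace.measurableSet_generateFrom ⟨k.natAbs, ω₀, ?_⟩
        ext ω
        simp only [Set.mem_preimage, Set.mem_singleton_iff, funext_iff, Subtype.forall,
          mem_windowSet, I, Set.mem_Icc, and_imp]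
    exact (@measurable_from_top _ _ _ fun f => f ⟨k, hkI⟩).comp hrestrict
  · apply MeasurableSpace.generateFrom_le
    rintro _ ⟨m, w, rfl⟩
    exact measurableSet_windowSet _ _ _

lemma ext_of_symmWindows {μ ν : Measure (ℤ → V)} [IsProbabilityMeasure μ]
    [IsProbabilityMeasure ν] (h : ∀ s ∈ symmWindows V, μ s = ν s) : μ = ν :=
  ext_of_generate_finite _ pi_eq_generateFrom_symmWindows isPiSystem_symmWindows h (by simp)

lemma ext_of_cylinder {μ ν : Measure (ℤ → V)} [IsProbabilityMeasure μ]
    [IsProbabilityMeasure ν] (hμ : MeasurePreserving shift μ μ) (hν : MeasurePreserving shift ν ν)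
    (h : ∀ (n : ℕ) (w : Fin (n + 1) → V), μ (cylinder w) = ν (cylinder w)) : μ = ν := by
  apply ext_of_symmWindows
  rintro _ ⟨m, w, rfl⟩
  rw [measure_symmWindow_eq_cylinder hμ, measure_symmWindow_eq_cylinder hν, h]

lemma tendsto_of_tendsto_cylinder [TopologicalSpace V] [DiscreteTopology V]
    [OpensMeasurableSpace (ℤ → V)]
    {μs : ℕ → ProbabilityMeasure (ℤ → V)} {μ : ProbabilityMeasure (ℤ → V)}
    (hμ : MeasurePreserving shift (μ : Measure (ℤ → V)) μ)
    (hμs : ∀ k, MeasurePreserving shift (μs k : Measure (ℤ → V)) (μs k))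
    (h : ∀ (n : ℕ) (w : Fin (n + 1) → V),
      Tendsto (fun k => (μs k : Measure (ℤ → V)) (cylinder w)) atTop
        (𝓝 ((μ : Measure (ℤ → V)) (cylinder w)))) :
    Tendsto μs atTop (𝓝 μ) := by
  apply isPiSystem_symmWindows.tendsto_probabilityMeasure_of_tendsto_of_mem
  · rintro _ ⟨m, w, rfl⟩
    exact measurableSet_windowSet _ _ _
  · exact fun u hu x hx => exists_symmWindow_subset hu hx
  · rintro _ ⟨m, w, rfl⟩
    have hcyl := h _ fun k : Fin (2 * (m + 1) + 1) => w (-(m + 1 : ℕ) + (k : ℕ))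
    simp_rw [← measure_symmWindow_eq_cylinder hμ, ← measure_symmWindow_eq_cylinder (hμs _)] at hcyl
    rw [← ENNReal.tendsto_coe]
    simpa only [ProbabilityMeasure.ennreal_coeFn_eq_coeFn_toMeasure] using hcyl

end Sequences

/-! ### Two-sided Markov measures -/

section Markov

variable {V : Type*}

/-- The orbit of a sequence of random self-maps of `V` that starts at `x none`: the map used at
time `n` sends `i` to `x (some (d n, i))`. The maps are tagged by `d = Sum.inl` when time runs
forward and by `d = Sum.inr` when it runs backward, so that the two orbits use disjoint
coordinates of `x`. -/
def orbitOf (d : ℕ → ℕ ⊕ ℕ) (x : Option ((ℕ ⊕ ℕ) × V) → V) : ℕ → V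
  | 0 => x none
  | n + 1 => x (some (d n, orbitOf d x n))

/-- The two-sided sequence made of the orbits in the two directions of time. -/
def twoSidedOrbit (x : Option ((ℕ ⊕ ℕ) × V) → V) : ℤ → V
  | Int.ofNat n => orbitOf Sum.inl x n
  | Int.negSucc n => orbitOf Sum.inr x (n + 1)

/-- The coordinates that determine whether the two-sided orbit agrees with `w` at the times
`-m, …, n`, namely the start and the maps evaluated along `w`. -/
def orbitCoords (m n : ℕ) (w : ℤ → V) : Finset (Option ((ℕ ⊕ ℕ) × V)) :=
  Finset.insertNone (((Finset.range n).disjSum (Finset.range m)).map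
    ⟨fun d => (d, Sum.elim (fun k : ℕ => w k) (fun k : ℕ => w (-k)) d),
      fun _ _ h => congrArg Prod.fst h⟩)

/-- The values at `orbitCoords` of those `x` whose two-sided orbit follows `w`. -/
def orbitValues (w : ℤ → V) : Option ((ℕ ⊕ ℕ) × V) → V
  | none => w 0
  | some (Sum.inl k, _) => w (k + 1)
  | some (Sum.inr k, _) => w (-(k + 1))

lemma orbitOf_eq_iff {d : ℕ → ℕ ⊕ ℕ} {x : Option ((ℕ ⊕ ℕ) × V) → V} {u : ℕ → V} {n : ℕ} :
    (∀ k ≤ n, orbitOf d x k = u k) ↔ x none = u 0 ∧ ∀ k < n, x (some (d k, u k)) = u (k + 1) := by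
  constructor
  · intro h
    refine ⟨h 0 (Nat.zero_le _), fun k hk => ?_⟩
    rw [← h k hk.le]
    exact h (k + 1) hk
  · rintro ⟨hzero, hstep⟩ k hk
    induction k with
    | zero => exact hzero
    | succ k ih => rw [orbitOf, ih (by omega), hstep k hk]

lemma twoSidedOrbit_natCast (x : Option ((ℕ ⊕ ℕ) × V) → V) (n : ℕ) :
    twoSidedOrbit x n = orbitOf Sum.inl x n := rfl

lemma twoSidedOrbit_neg_natCast (x : Option ((ℕ ⊕ ℕ) × V) → V) :
    ∀ n : ℕ, twoSidedOrbit x (-n) = orbitOf Sum.inr x n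
  | 0 => rfl
  | _ + 1 => rfl

lemma twoSidedOrbit_mem_windowSet {x : Option ((ℕ ⊕ ℕ) × V) → V} {m n : ℕ} {w : ℤ → V} :
    twoSidedOrbit x ∈ windowSet (-(m : ℤ)) n w ↔
      (∀ k ≤ n, orbitOf Sum.inl x k = w k) ∧ ∀ k ≤ m, orbitOf Sum.inr x k = w (-k) := by
  rw [mem_windowSet]
  constructor
  · intro h
    refine ⟨fun k hk => ?_, fun k hk => ?_⟩
    · rw [← twoSidedOrbit_natCast, h k (by omega) (by omega)]
    · rw [← twoSidedOrbit_neg_natCast, h (-k) (by omega) (by omega)]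
  · rintro ⟨hpos, hneg⟩ k hmk hkn
    obtain ⟨k, rfl | rfl⟩ := k.eq_nat_or_neg
    · rw [twoSidedOrbit_natCast, hpos k (by omega)]
    · rw [twoSidedOrbit_neg_natCast, hneg k (by omega)]

lemma preimage_twoSidedOrbit_windowSet (m n : ℕ) (w : ℤ → V) :
    twoSidedOrbit ⁻¹' windowSet (-m) n w =
      Set.pi (orbitCoords m n w : Set (Option ((ℕ ⊕ ℕ) × V))) fun o => {orbitValues w o} := by
  ext x
  rw [Set.mem_preimage, twoSidedOrbit_mem_windowSet, orbitOf_eq_iff (u := fun k => w k),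
    orbitOf_eq_iff (u := fun k => w (-k))]
  simp only [Nat.cast_zero, neg_zero, Nat.cast_add, Nat.cast_one, Set.mem_pi, Finset.mem_coe,
    orbitCoords, Option.forall, Finset.none_mem_insertNone, Finset.some_mem_insertNone,
    Finset.mem_map, Finset.mem_disjSum, Finset.mem_range, Set.mem_singleton_iff, orbitValues,
    forall_exists_index, and_imp]
  constructor
  · rintro ⟨⟨hzero, hpos⟩, -, hneg⟩
    refine ⟨fun _ => hzero, ?_⟩
    rintro _ _ (⟨k, hk, rfl⟩ | ⟨k, hk, rfl⟩) rfl
    exacts [hpos k hk, hneg k hk]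
  · rintro ⟨hzero, h⟩
    exact ⟨⟨hzero trivial, fun k hk => h _ _ (Or.inl ⟨k, hk, rfl⟩) rfl⟩, hzero trivial,
      fun k hk => h _ _ (Or.inr ⟨k, hk, rfl⟩) rfl⟩

/-- The laws of the random maps behind a two-sided Markov chain: the initial distribution `π`, the
forward transition probabilities `p` and the backward transition probabilities `q`. -/
def stepLaw (π : PMF V) (p q : V → PMF V) : Option ((ℕ ⊕ ℕ) × V) → PMF V
  | none => π
  | some (Sum.inl _, i) => p i
  | some (Sum.inr _, i) => q i

variable {π : PMF V} {p q : V → PMF V}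

lemma prod_forward_mul_prod_backward (hpq : ∀ i j, π i * p i j = π j * q j i) (m n : ℕ)
    (w : ℤ → V) :
    π (w 0) * ((∏ k ∈ Finset.range n, p (w k) (w (k + 1))) *
        ∏ k ∈ Finset.range m, q (w (-k)) (w (-(k + 1)))) =
      π (w (-m)) * ∏ k ∈ Finset.range (m + n), p (w (-m + k)) (w (-m + k + 1)) := by
  induction m with
  | zero => simp
  | succ m ih =>
    have htail : ∀ k : ℕ, -((m + 1 : ℕ) : ℤ) + ((k + 1 : ℕ) : ℤ) = -m + k := fun k => by
      push_cast; ring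
    have hhead : -((m + 1 : ℕ) : ℤ) + ((0 : ℕ) : ℤ) = -(m + 1) := by push_cast; ring
    rw [Finset.prod_range_succ, ← mul_assoc, ← mul_assoc, mul_assoc (π (w 0)), ih,
      show m + 1 + n = (m + n) + 1 by ring, Finset.prod_range_succ']
    simp_rw [htail]
    rw [hhead, show -((m : ℤ) + 1) + 1 = -m by ring, Nat.cast_succ, mul_right_comm, ← hpq]
    ring

variable [MeasurableSpace V] [DiscreteMeasurableSpace V] [Countable V]

lemma measurable_orbitOf (d : ℕ → ℕ ⊕ ℕ) (n : ℕ) :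
    Measurable fun x : Option ((ℕ ⊕ ℕ) × V) → V => orbitOf d x n := by
  induction n with
  | zero => exact measurable_pi_apply _
  | succ n ih =>
    have heval : Measurable fun q : (Option ((ℕ ⊕ ℕ) × V) → V) × V => q.1 (some (d n, q.2)) :=
      measurable_from_prod_countable_left fun i => measurable_pi_apply (some (d n, i))
    exact heval.comp (measurable_id.prodMk ih)

lemma measurable_twoSidedOrbit :
    Measurable (twoSidedOrbit : (Option ((ℕ ⊕ ℕ) × V) → V) → ℤ → V) := by
  refine measurable_pi_lambda _ fun k => ?_
  cases k
  exacts [measurable_orbitOf _ _, measurable_orbitOf _ _]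

/-- The law of the two-sided chain that starts at time `0` with distribution `π` and moves forward
with transition probabilities `p` and backward with `q`. It is the stationary Markov chain `(π, p)`
if `q` is the time reversal of `p`. -/
def markovMeasure (π : PMF V) (p q : V → PMF V) : ProbabilityMeasure (ℤ → V) :=
  ⟨(Measure.infinitePi fun o => (stepLaw π p q o).toMeasure).map twoSidedOrbit,
    Measure.isProbabilityMeasure_map measurable_twoSidedOrbit.aemeasurable⟩

lemma markovMeasure_windowSet (hpq : ∀ i j, π i * p i j = π j * q j i) (m n : ℕ) (w : ℤ → V) :
    (markovMeasure π p q : Measure (ℤ → V)) (windowSet (-m) n w) =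
      π (w (-m)) * ∏ k ∈ Finset.range (m + n), p (w (-m + k)) (w (-m + k + 1)) := by
  change ((Measure.infinitePi fun o => (stepLaw π p q o).toMeasure).map twoSidedOrbit) _ = _
  rw [Measure.map_apply measurable_twoSidedOrbit (measurableSet_windowSet _ _ _),
    preimage_twoSidedOrbit_windowSet,
    Measure.infinitePi_pi _ fun _ _ => MeasurableSet.of_discrete]
  simp_rw [PMF.toMeasure_apply_singleton _ _ MeasurableSet.of_discrete]
  rw [orbitCoords, Finset.prod_insertNone, Finset.prod_map, Finset.prod_disjSum,
    ← prod_forward_mul_prod_backward hpq]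
  rfl

lemma measurePreserving_shift_markovMeasure (hpq : ∀ i j, π i * p i j = π j * q j i) :
    MeasurePreserving shift (markovMeasure π p q : Measure (ℤ → V)) (markovMeasure π p q) := by
  have hmeas : Measurable (shift : (ℤ → V) → ℤ → V) := measurable_shiftBy 1
  have := Measure.isProbabilityMeasure_map (μ := (markovMeasure π p q : Measure (ℤ → V)))
    hmeas.aemeasurable
  refine ⟨hmeas, ext_of_symmWindows ?_⟩
  rintro _ ⟨m, w, rfl⟩
  have hpre : shift ⁻¹' windowSet (-((m + 1 : ℕ) : ℤ)) (m + 1 : ℕ) w =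
      windowSet (-(m : ℤ)) (m + 2 : ℕ) fun k => w (k - 1) := by
    refine (preimage_shiftBy_windowSet 1 _ _ w).trans ?_
    congr 1
    · push_cast
      ring
  rw [Measure.map_apply hmeas (measurableSet_windowSet _ _ _), hpre, markovMeasure_windowSet hpq,
    markovMeasure_windowSet hpq, show m + (m + 2) = m + 1 + (m + 1) by ring]
  have htime : ∀ k : ℤ, -((m + 1 : ℕ) : ℤ) + k = -m + k - 1 := fun k => by push_cast; ring
  simp_rw [htime, sub_add_cancel, add_sub_cancel_right]
  rw [← add_zero (-((m + 1 : ℕ) : ℤ)), htime, add_zero]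

lemma markovMeasure_cylinder (hpq : ∀ i j, π i * p i j = π j * q j i) {n : ℕ}
    (w : Fin (n + 1) → V) :
    (markovMeasure π p q : Measure (ℤ → V)) (cylinder w) =
      π (w 0) * ∏ i : Fin n, p (w i.castSucc) (w i.succ) := by
  obtain ⟨w, rfl⟩ := exists_int_extension w
  have h := markovMeasure_windowSet hpq 0 n w
  rw [Nat.cast_zero, neg_zero] at h
  rw [cylinder_eq_windowSet, h, zero_add, ← Fin.prod_univ_eq_prod_range fun k : ℕ => p _ _]
  simp

end Markov

/-! ### Gibbs' inequality -/

open InformationTheory in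
/-- For a probability vector `m` and conditional probabilities `m / M`, `p`: the total relative
entropy `∑ M p klFun (m / (M p))` of `m` with respect to `M p`. -/
def relEntropy {α : Type*} (m M p : α → ℝ) : ℝ≥0∞ :=
  ∑' a, ENNReal.ofReal (M a * p a * klFun (m a / (M a * p a)))

section Gibbs

open InformationTheory

lemma mul_neg_log_add_eq {m M p : ℝ} (hM : M = 0 → m = 0) (hp : p = 0 → m = 0) :
    m * -Real.log p + M * p = m * Real.log (M / m) + M * p * klFun (m / (M * p)) + m := by
  by_cases hm : m = 0
  · simp [hm, klFun_zero]
  have hM0 : M ≠ 0 := mt hM hm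
  have hp0 : p ≠ 0 := mt hp hm
  rw [klFun, Real.log_div hM0 hm, Real.log_div hm (mul_ne_zero hM0 hp0), Real.log_mul hM0 hp0]
  field_simp
  ring

lemma mul_log_div_nonneg {m M : ℝ} (hm : 0 ≤ m) (hM : m ≤ M) : 0 ≤ m * Real.log (M / m) := by
  rcases hm.eq_or_lt with rfl | hpos
  · simp
  · exact mul_nonneg hm (Real.log_nonneg ((one_le_div hpos).mpr hM))

variable {α : Type*} {m M p : α → ℝ}

lemma tsum_mul_neg_log_eq_add_relEntropy (hm : ∀ a, 0 ≤ m a) (hM : ∀ a, m a ≤ M a)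
    (hp : ∀ a, 0 ≤ p a) (hp_le : ∀ a, p a ≤ 1) (hp_zero : ∀ a, p a = 0 → m a = 0)
    (hm_sum : ∑' a, ENNReal.ofReal (m a) = 1) (hMp_sum : ∑' a, ENNReal.ofReal (M a * p a) = 1) :
    ∑' a, ENNReal.ofReal (m a * -Real.log (p a)) =
      ∑' a, ENNReal.ofReal (m a * Real.log (M a / m a)) + relEntropy m M p := by
  have hMp : ∀ a, 0 ≤ M a * p a := fun a => mul_nonneg ((hm a).trans (hM a)) (hp a)
  have hterm : ∀ a, ENNReal.ofReal (m a * -Real.log (p a)) + ENNReal.ofReal (M a * p a) =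
      ENNReal.ofReal (m a * Real.log (M a / m a)) +
        ENNReal.ofReal (M a * p a * klFun (m a / (M a * p a))) + ENNReal.ofReal (m a) := by
    intro a
    have hlog : 0 ≤ m a * Real.log (M a / m a) := mul_log_div_nonneg (hm a) (hM a)
    have hkl : 0 ≤ M a * p a * klFun (m a / (M a * p a)) :=
      mul_nonneg (hMp a) (klFun_nonneg (div_nonneg (hm a) (hMp a)))
    rw [← ENNReal.ofReal_add
        (mul_nonneg (hm a) (neg_nonneg.mpr (Real.log_nonpos (hp a) (hp_le a)))) (hMp a),
      ← ENNReal.ofReal_add hlog hkl, ← ENNReal.ofReal_add (add_nonneg hlog hkl) (hm a),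
      mul_neg_log_add_eq (fun h => le_antisymm ((hM a).trans_eq h) (hm a)) (hp_zero a)]
  rw [relEntropy]
  have hsum := tsum_congr (L := .unconditional α) hterm
  simp only [ENNReal.tsum_add, hm_sum, hMp_sum] at hsum
  exact (ENNReal.add_left_inj ENNReal.one_ne_top).mp hsum

lemma relEntropy_eq_zero_iff (hm : ∀ a, 0 ≤ m a) (hMp : ∀ a, 0 ≤ M a * p a)
    (hMp_zero : ∀ a, M a * p a = 0 → m a = 0) :
    relEntropy m M p = 0 ↔ ∀ a, m a = M a * p a := by
  rw [relEntropy, ENNReal.tsum_eq_zero]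
  refine forall_congr' fun a => ?_
  have hx : 0 ≤ m a / (M a * p a) := div_nonneg (hm a) (hMp a)
  rw [ENNReal.ofReal_eq_zero, (mul_nonneg (hMp a) (klFun_nonneg hx)).ge_iff_eq', mul_eq_zero,
    klFun_eq_zero_iff hx]
  by_cases h0 : M a * p a = 0
  · simp [h0, hMp_zero a h0]
  · simp [h0, div_eq_one_iff_eq h0]

end Gibbs

/-! ### Integrable coboundaries -/

section Coboundary

/-- The truncation of a real number to the interval `[-M, M]`. -/
def truncate (M : ℕ) (x : ℝ) : ℝ := max (-M) (min M x)

lemma measurable_truncate (M : ℕ) : Measurable (truncate M) :=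
  measurable_const.max (measurable_const.min measurable_id)

lemma abs_truncate_le (M : ℕ) (x : ℝ) : |truncate M x| ≤ M :=
  abs_le.mpr ⟨le_max_left _ _, max_le (neg_le_self M.cast_nonneg) (min_le_left _ _)⟩

lemma monotone_truncate (M : ℕ) : Monotone (truncate M) :=
  fun _ _ h => max_le_max le_rfl (min_le_min le_rfl h)

lemma abs_truncate_sub_le (M : ℕ) (x y : ℝ) : |truncate M x - truncate M y| ≤ |x - y| :=
  (abs_max_sub_max_le_max _ _ _ _).trans <| max_le (by simp) <|
    (abs_min_sub_min_le_max _ _ _ _).trans <| max_le (by simp) le_rfl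

lemma tendsto_truncate (x : ℝ) : Tendsto (fun M => truncate M x) atTop (𝓝 x) := by
  obtain ⟨M₀, hM₀⟩ := exists_nat_ge |x|
  refine tendsto_const_nhds.congr' ?_
  filter_upwards [eventually_ge_atTop M₀] with M hM
  obtain ⟨hneg, hpos⟩ := abs_le.mp (hM₀.trans (Nat.cast_le.mpr hM))
  rw [truncate, min_eq_right hpos, max_eq_right hneg]

lemma abs_truncate_sub_le_add {x y c : ℝ} (hc : 0 ≤ c) (M : ℕ) :
    |truncate M x - truncate M y| ≤ truncate M x - truncate M y + 2 * |x - y - c| := by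
  rcases le_total y x with hyx | hxy
  · rw [abs_of_nonneg (sub_nonneg.mpr (monotone_truncate M hyx))]
    exact le_add_of_nonneg_right (by positivity)
  · have hlip := abs_truncate_sub_le M x y
    have htr := sub_nonpos.mpr (monotone_truncate M hxy)
    rw [abs_of_nonpos htr, abs_of_nonpos (sub_nonpos.mpr hxy)] at hlip
    rw [abs_of_nonpos htr]
    linarith [neg_abs_le (x - y - c)]

variable {Ω : Type*} [MeasurableSpace Ω] {μ : Measure Ω} {T : Ω → Ω} {k c : Ω → ℝ}

lemma integrable_truncate [IsFiniteMeasure μ] (hk : Measurable k) (M : ℕ) :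
    Integrable (fun ω => truncate M (k ω)) μ :=
  .of_bound ((measurable_truncate M).comp hk).aestronglyMeasurable M
    (ae_of_all _ fun ω => abs_truncate_le M (k ω))

lemma integral_coboundary_eq_zero_of_integrable (hT : MeasurePreserving T μ μ)
    (hk : Integrable k μ) : ∫ ω, (k ω - k (T ω)) ∂μ = 0 := by
  have hmap : ∫ ω, k (T ω) ∂μ = ∫ ω, k ω ∂μ := by
    conv_rhs => rw [← hT.map_eq]
    exact (integral_map hT.aemeasurable (hT.map_eq.symm ▸ hk.aestronglyMeasurable)).symm
  have hkT : Integrable (fun ω => k (T ω)) μ := hT.integrable_comp_of_integrable hk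
  rw [integral_sub hk hkT, hmap, sub_self]

variable [IsFiniteMeasure μ]

lemma lintegral_enorm_truncate_coboundary_le (hT : MeasurePreserving T μ μ) (hk : Measurable k)
    (hc : ∀ ω, 0 ≤ c ω) (hint : Integrable (fun ω => k ω - k (T ω) - c ω) μ) (M : ℕ) :
    ∫⁻ ω, ‖truncate M (k ω) - truncate M (k (T ω))‖ₑ ∂μ ≤
      ENNReal.ofReal (∫ ω, 2 * |k ω - k (T ω) - c ω| ∂μ) := by
  have htr := integrable_truncate (μ := μ) hk M
  have hcob : Integrable (fun ω => truncate M (k ω) - truncate M (k (T ω))) μ :=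
    htr.sub (hT.integrable_comp_of_integrable htr)
  have herr : Integrable (fun ω => 2 * |k ω - k (T ω) - c ω|) μ := hint.abs.const_mul 2
  rw [← ofReal_integral_norm_eq_lintegral_enorm hcob]
  refine ENNReal.ofReal_le_ofReal ?_
  calc ∫ ω, ‖truncate M (k ω) - truncate M (k (T ω))‖ ∂μ
      ≤ ∫ ω, (truncate M (k ω) - truncate M (k (T ω)) + 2 * |k ω - k (T ω) - c ω|) ∂μ :=
        integral_mono hcob.norm (hcob.add herr) fun ω => abs_truncate_sub_le_add (hc ω) M
    _ = ∫ ω, 2 * |k ω - k (T ω) - c ω| ∂μ := by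
        rw [integral_add hcob herr, integral_coboundary_eq_zero_of_integrable hT htr, zero_add]

lemma integrable_coboundary (hT : MeasurePreserving T μ μ) (hk : Measurable k)
    (hc : ∀ ω, 0 ≤ c ω) (hint : Integrable (fun ω => k ω - k (T ω) - c ω) μ) :
    Integrable (fun ω => k ω - k (T ω)) μ := by
  have hmeas : ∀ M, Measurable fun ω => truncate M (k ω) - truncate M (k (T ω)) := fun M =>
    ((measurable_truncate M).comp hk).sub ((measurable_truncate M).comp (hk.comp hT.measurable))
  refine ⟨(hk.sub (hk.comp hT.measurable)).aestronglyMeasurable, ?_⟩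
  have hlim : ∀ ω, ‖k ω - k (T ω)‖ₑ =
      liminf (fun M => ‖truncate M (k ω) - truncate M (k (T ω))‖ₑ) atTop := fun ω =>
    (((tendsto_truncate _).sub (tendsto_truncate _)).enorm).liminf_eq.symm
  simp_rw [HasFiniteIntegral, hlim]
  calc ∫⁻ ω, liminf (fun M => ‖truncate M (k ω) - truncate M (k (T ω))‖ₑ) atTop ∂μ
      ≤ liminf (fun M => ∫⁻ ω, ‖truncate M (k ω) - truncate M (k (T ω))‖ₑ ∂μ) atTop :=
        lintegral_liminf_le fun M => (hmeas M).enorm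
    _ ≤ ENNReal.ofReal (∫ ω, 2 * |k ω - k (T ω) - c ω| ∂μ) :=
        (liminf_le_liminf (Eventually.of_forall
          (lintegral_enorm_truncate_coboundary_le hT hk hc hint))).trans_eq (liminf_const _)
    _ < ∞ := ENNReal.ofReal_lt_top

lemma integral_coboundary_eq_zero (hT : MeasurePreserving T μ μ) (hk : Measurable k)
    (hint : Integrable (fun ω => k ω - k (T ω)) μ) : ∫ ω, (k ω - k (T ω)) ∂μ = 0 := by
  have hlim := tendsto_integral_of_dominated_convergence (fun ω => |k ω - k (T ω)|)
    (fun M => (((measurable_truncate M).comp hk).sub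
      ((measurable_truncate M).comp (hk.comp hT.measurable))).aestronglyMeasurable) hint.abs
    (fun M => ae_of_all _ fun ω => abs_truncate_sub_le M (k ω) (k (T ω)))
    (ae_of_all _ fun ω => (tendsto_truncate (k ω)).sub (tendsto_truncate (k (T ω))))
  refine tendsto_nhds_unique hlim (tendsto_const_nhds.congr fun M => ?_)
  exact (integral_coboundary_eq_zero_of_integrable hT (integrable_truncate hk M)).symm

end Coboundary

/-! ### Entropy and cross entropy -/

section Entropy

variable {V : Type*}

/-- The information content `-log p(i, j)` of a transition. -/
def surprisal (p : V → PMF V) (i j : V) : ℝ := -Real.log (p i j).toReal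

lemma surprisal_nonneg (p : V → PMF V) (i j : V) : 0 ≤ surprisal p i j :=
  neg_nonneg.mpr <| Real.log_nonpos ENNReal.toReal_nonneg <|
    (ENNReal.toReal_mono ENNReal.one_ne_top ((p i).coe_le_one j)).trans_eq ENNReal.toReal_one

/-- The probability of the last transition of a word. -/
def lastProb (p : V → PMF V) {n : ℕ} (u : Fin (n + 2) → V) : ℝ≥0∞ :=
  p (u (Fin.last n).castSucc) (u (Fin.last (n + 1)))

lemma lastProb_ne_top (p : V → PMF V) {n : ℕ} (u : Fin (n + 2) → V) : lastProb p u ≠ ∞ :=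
  (p _).apply_ne_top _

/-- The word read at the times `0, …, n - 1`. -/
def wordAt (n : ℕ) (ω : ℤ → V) : Fin n → V := fun i => ω (i : ℕ)

lemma cylinder_eq_preimage_wordAt {n : ℕ} (u : Fin n → V) : cylinder u = wordAt n ⁻¹' {u} := by
  ext ω
  exact funext_iff.symm

lemma cylinder_fin_one (w : Fin 1 → V) : (cylinder w : Set (ℤ → V)) = {ω | ω 0 = w 0} := by
  ext ω
  exact Fin.forall_fin_one

variable [MeasurableSpace V]

/-- The expected information content of a transition. -/
def crossEntropy (p : V → PMF V) (ν : Measure (ℤ → V)) : ℝ≥0∞ :=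
  ∫⁻ ω, ENNReal.ofReal (surprisal p (ω 0) (ω 1)) ∂ν

/-- The relative entropy of `ν` on words of length `n + 2` with respect to the law which makes the
last transition with the probabilities `p`. -/
def lastRelEntropy (p : V → PMF V) (ν : Measure (ℤ → V)) (n : ℕ) : ℝ≥0∞ :=
  relEntropy (fun u : Fin (n + 2) → V => ν.real (cylinder u))
    (fun u => ν.real (cylinder (Fin.init u))) (fun u => (lastProb p u).toReal)

/-- The Markov property, with transition probabilities `p`, of the law of the nonnegative times. -/
def IsMarkov (ν : Measure (ℤ → V)) (p : V → PMF V) : Prop :=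
  ∀ (n : ℕ) (u : Fin (n + 2) → V), ν (cylinder u) = ν (cylinder (Fin.init u)) * lastProb p u

variable {p : V → PMF V} {ν : Measure (ℤ → V)}

lemma measureReal_cylinder_le [IsFiniteMeasure ν] {n : ℕ} (u : Fin (n + 1) → V) :
    ν.real (cylinder u) ≤ ν.real (cylinder (Fin.init u)) :=
  measureReal_mono fun _ h i => h i.castSucc

lemma ofReal_measureReal_mul [IsFiniteMeasure ν] (s : Set (ℤ → V)) (x : ℝ) :
    ENNReal.ofReal (ν.real s * x) = ENNReal.ofReal x * ν s := by
  rw [ENNReal.ofReal_mul measureReal_nonneg, ofReal_measureReal, mul_comm]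

lemma IsMarkov.measure_cylinder_eq_zero (h : IsMarkov ν p) {n : ℕ} (u : Fin (n + 2) → V)
    (hu : lastProb p u = 0) : ν (cylinder u) = 0 := by
  rw [h n u, hu, mul_zero]

lemma lastRelEntropy_eq_zero_iff [IsFiniteMeasure ν] {n : ℕ}
    (hsupp : ∀ u : Fin (n + 2) → V, lastProb p u = 0 → ν (cylinder u) = 0) :
    lastRelEntropy p ν n = 0 ↔
      ∀ u : Fin (n + 2) → V, ν (cylinder u) = ν (cylinder (Fin.init u)) * lastProb p u := by
  rw [lastRelEntropy, relEntropy_eq_zero_iff (fun _ => measureReal_nonneg)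
    (fun _ => mul_nonneg measureReal_nonneg ENNReal.toReal_nonneg)]
  · refine forall_congr' fun u => ?_
    rw [Measure.real, Measure.real, ← ENNReal.toReal_mul, ENNReal.toReal_eq_toReal_iff'
      (measure_ne_top _ _) (ENNReal.mul_ne_top (measure_ne_top _ _) (lastProb_ne_top p u))]
  · intro u hu
    rcases mul_eq_zero.mp hu with hu | hu
    · exact le_antisymm ((measureReal_cylinder_le u).trans_eq hu) measureReal_nonneg
    · rw [Measure.real, hsupp u ((ENNReal.toReal_eq_zero_iff _).mp hu |>.resolve_right
        (lastProb_ne_top p u)), ENNReal.toReal_zero]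

variable [DiscreteMeasurableSpace V] [Countable V]

variable (ν) in
lemma tsum_mul_cylinder (n : ℕ) (f : (Fin n → V) → ℝ≥0∞) :
    ∑' u, f u * ν (cylinder u) = ∫⁻ ω, f (wordAt n ω) ∂ν := by
  have hw : Measurable (wordAt n : (ℤ → V) → Fin n → V) :=
    measurable_pi_lambda _ fun _ => measurable_pi_apply _
  rw [← lintegral_map Measurable.of_discrete hw, lintegral_countable']
  congr with u
  rw [Measure.map_apply hw (MeasurableSet.singleton u), cylinder_eq_preimage_wordAt]

lemma tsum_cylinder [IsProbabilityMeasure ν] (n : ℕ) :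
    ∑' u : Fin n → V, ν (cylinder u) = 1 := by
  simpa using tsum_mul_cylinder ν n fun _ => 1

lemma tsum_cylinder_init_mul_lastProb [IsProbabilityMeasure ν] (p : V → PMF V) (n : ℕ) :
    ∑' u : Fin (n + 2) → V, ν (cylinder (Fin.init u)) * lastProb p u = 1 := by
  rw [← (Fin.snocEquiv fun _ => V).tsum_eq, ENNReal.tsum_prod', ENNReal.tsum_comm,
    ← tsum_cylinder (ν := ν) (n + 1)]
  refine tsum_congr fun w => ?_
  have hinit : ∀ a : V, (Fin.init ((Fin.snocEquiv fun _ => V) (a, w)) : Fin (n + 1) → V) = w :=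
    fun a => Fin.init_snoc (α := fun _ => V) a w
  simp only [hinit, lastProb, Fin.snocEquiv_apply, Fin.snoc_castSucc, Fin.snoc_last]
  rw [ENNReal.tsum_mul_left, PMF.tsum_coe, mul_one]

lemma lintegral_pair_eq (hν : MeasurePreserving shift ν ν) (f : V → V → ℝ≥0∞) (n : ℕ) :
    ∫⁻ ω, f (ω n) (ω (n + 1 : ℕ)) ∂ν = ∫⁻ ω, f (ω 0) (ω 1) ∂ν := by
  have hpair : Measurable fun ω : ℤ → V => (ω 0, ω 1) :=
    (measurable_pi_apply 0).prodMk (measurable_pi_apply 1)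
  have hf : Measurable fun ω : ℤ → V => f (ω 0) (ω 1) :=
    (Measurable.of_discrete (f := Function.uncurry f)).comp hpair
  rw [← (measurePreserving_shiftBy hν n).lintegral_comp hf]
  simp [shiftBy, add_comm]

lemma crossEntropy_eq_tsum [IsFiniteMeasure ν] (hν : MeasurePreserving shift ν ν) (n : ℕ) :
    crossEntropy p ν = ∑' u : Fin (n + 2) → V,
      ENNReal.ofReal (ν.real (cylinder u) * -Real.log (lastProb p u).toReal) := by
  simp_rw [ofReal_measureReal_mul]
  rw [tsum_mul_cylinder ν (n + 2) fun u => ENNReal.ofReal (-Real.log (lastProb p u).toReal),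
    crossEntropy, ← lintegral_pair_eq hν (fun i j => ENNReal.ofReal (surprisal p i j)) n]
  rfl

lemma crossEntropy_eq_condEntropy_add [IsProbabilityMeasure ν]
    (hν : MeasurePreserving shift ν ν) {n : ℕ}
    (hsupp : ∀ u : Fin (n + 2) → V, lastProb p u = 0 → ν (cylinder u) = 0) :
    crossEntropy p ν = condEntropy ν (n + 1) + lastRelEntropy p ν n := by
  rw [crossEntropy_eq_tsum hν n]
  refine tsum_mul_neg_log_eq_add_relEntropy (fun _ => measureReal_nonneg) measureReal_cylinder_le
    (fun _ => ENNReal.toReal_nonneg) (fun u => ?_) (fun u hu => ?_) ?_ ?_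
  · exact (ENNReal.toReal_mono ENNReal.one_ne_top ((p _).coe_le_one _)).trans_eq
      ENNReal.toReal_one
  · rw [Measure.real, hsupp u (((ENNReal.toReal_eq_zero_iff _).mp hu).resolve_right
      (lastProb_ne_top p u)), ENNReal.toReal_zero]
  · exact (tsum_congr fun _ => ofReal_measureReal).trans (tsum_cylinder _)
  · rw [← tsum_cylinder_init_mul_lastProb (ν := ν) p n]
    refine tsum_congr fun u => ?_
    rw [ofReal_measureReal_mul, ENNReal.ofReal_toReal (lastProb_ne_top p u), mul_comm]

/-- The law of the coordinate at time `0`. -/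
def marginal (ν : Measure (ℤ → V)) [IsProbabilityMeasure ν] : PMF V :=
  haveI : IsProbabilityMeasure (ν.map fun ω => ω 0) :=
    Measure.isProbabilityMeasure_map (measurable_pi_apply 0).aemeasurable
  (ν.map fun ω => ω 0).toPMF

variable [IsProbabilityMeasure ν]

lemma marginal_apply (i : V) : marginal ν i = ν {ω | ω 0 = i} :=
  Measure.map_apply (measurable_pi_apply 0) (MeasurableSet.singleton i)

lemma measure_coord_one_eq_marginal (hν : MeasurePreserving shift ν ν) (i : V) :
    ν {ω | ω 1 = i} = marginal ν i := by
  rw [marginal_apply]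
  exact hν.measure_preimage
    (measurable_pi_apply 0 (MeasurableSet.singleton i)).nullMeasurableSet

lemma condEntropy_zero_eq_lintegral :
    condEntropy ν 0 = ∫⁻ ω, ENNReal.ofReal (-Real.log (marginal ν (ω 0)).toReal) ∂ν := by
  refine Eq.trans (tsum_congr fun u => ?_)
    (tsum_mul_cylinder ν 1 fun u => ENNReal.ofReal (-Real.log (marginal ν (u 0)).toReal))
  have huniv : (cylinder (Fin.init u) : Set (ℤ → V)) = Set.univ :=
    Set.eq_univ_of_forall fun _ i => i.elim0
  rw [huniv, probReal_univ, one_div, Real.log_inv, ofReal_measureReal_mul, marginal_apply,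
    cylinder_fin_one, Measure.real]

lemma crossEntropy_marginal_eq_condEntropy_zero (hν : MeasurePreserving shift ν ν) :
    crossEntropy (fun _ => marginal ν) ν = condEntropy ν 0 := by
  have hmeas : Measurable fun ω : ℤ → V => ENNReal.ofReal (-Real.log (marginal ν (ω 0)).toReal) :=
    (Measurable.of_discrete
      (f := fun i => ENNReal.ofReal (-Real.log (marginal ν i).toReal))).comp (measurable_pi_apply 0)
  rw [condEntropy_zero_eq_lintegral, ← hν.lintegral_comp hmeas]
  rfl

lemma condEntropy_one_le_condEntropy_zero (hν : MeasurePreserving shift ν ν) :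
    condEntropy ν 1 ≤ condEntropy ν 0 := by
  have hsupp : ∀ u : Fin 2 → V, lastProb (fun _ => marginal ν) u = 0 → ν (cylinder u) = 0 := by
    intro u hu
    rw [lastProb, ← measure_coord_one_eq_marginal hν] at hu
    exact measure_mono_null (fun ω hω => hω 1) hu
  rw [← crossEntropy_marginal_eq_condEntropy_zero hν, crossEntropy_eq_condEntropy_add hν hsupp]
  exact le_self_add

lemma entropy_eq_crossEntropy (hν : MeasurePreserving shift ν ν) (h : IsMarkov ν p) :
    entropy ν = crossEntropy p ν := by
  have hcond : ∀ n, condEntropy ν (n + 1) = crossEntropy p ν := fun n => by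
    rw [crossEntropy_eq_condEntropy_add hν h.measure_cylinder_eq_zero,
      (lastRelEntropy_eq_zero_iff h.measure_cylinder_eq_zero).mpr (h n), add_zero]
  refine le_antisymm ((iInf_le _ 1).trans_eq (hcond 0)) (le_iInf fun n => ?_)
  cases n with
  | zero => exact (hcond 0).symm.trans_le (condEntropy_one_le_condEntropy_zero hν)
  | succ n => exact (hcond n).ge

lemma entropy_add_lastRelEntropy_le (hν : MeasurePreserving shift ν ν) {n : ℕ}
    (hsupp : ∀ u : Fin (n + 2) → V, lastProb p u = 0 → ν (cylinder u) = 0) :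
    entropy ν + lastRelEntropy p ν n ≤ crossEntropy p ν := by
  rw [crossEntropy_eq_condEntropy_add hν hsupp]
  exact add_le_add_left (iInf_le _ _) _

end Entropy

/-! ### The variational principle -/

section FreeEnergy

variable {V : Type*} [MeasurableSpace V]

/-- Up to the coboundary of `κ` and the constant `P`, the potential `log W` is `ν`-almost surely the
logarithm of the transition probabilities `p`. -/
def IsCohomologous (ν : Measure (ℤ → V)) (W : V → V → ℝ≥0) (p : V → PMF V) (P : ℝ) (κ : V → ℝ) :
    Prop :=
  ∀ᵐ ω ∂ν, Real.log (W (ω 0) (ω 1)) = P - surprisal p (ω 0) (ω 1) + κ (ω 0) - κ (ω 1)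

variable {ν : Measure (ℤ → V)} {W : V → V → ℝ≥0} {p : V → PMF V} {P : ℝ} {κ : V → ℝ}

lemma IsCohomologous.add_coboundary_ae_eq (hW : IsCohomologous ν W p P κ) (g : V → ℝ) :
    (fun ω : ℤ → V => Real.log (W (ω 0) (ω 1)) + g (ω 0) - g (ω 1)) =ᵐ[ν]
      fun ω => P + (((g + κ) (ω 0) - (g + κ) (shift ω 0)) - surprisal p (ω 0) (ω 1)) := by
  filter_upwards [hW] with ω hω
  rw [hω]
  simp only [shift, zero_add, Pi.add_apply]
  ring

lemma integral_surprisal_eq (hint : Integrable (fun ω => surprisal p (ω 0) (ω 1)) ν) :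
    ∫ ω, surprisal p (ω 0) (ω 1) ∂ν = (crossEntropy p ν).toReal :=
  integral_eq_lintegral_of_nonneg_ae (ae_of_all _ fun _ => surprisal_nonneg p _ _) hint.1

lemma IsCohomologous.integrable_iff [IsFiniteMeasure ν]
    (hW : IsCohomologous ν W p P κ) (g : V → ℝ) :
    Integrable (fun ω : ℤ → V => Real.log (W (ω 0) (ω 1)) + g (ω 0) - g (ω 1)) ν ↔
      Integrable (fun ω : ℤ → V =>
        ((g + κ) (ω 0) - (g + κ) (shift ω 0)) - surprisal p (ω 0) (ω 1)) ν := by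
  rw [integrable_congr (hW.add_coboundary_ae_eq g)]
  exact integrable_const_add_iff

variable [DiscreteMeasurableSpace V]

lemma measurable_comp_zero (g : V → ℝ) : Measurable fun ω : ℤ → V => g (ω 0) :=
  Measurable.of_discrete.comp (measurable_pi_apply 0)

lemma IsCohomologous.integrable_coboundary [IsFiniteMeasure ν]
    (hW : IsCohomologous ν W p P κ) (hν : MeasurePreserving shift ν ν) {g : V → ℝ}
    (hg : Integrable (fun ω : ℤ → V => Real.log (W (ω 0) (ω 1)) + g (ω 0) - g (ω 1)) ν) :
    Integrable (fun ω : ℤ → V => (g + κ) (ω 0) - (g + κ) (shift ω 0)) ν :=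
  LoadedGraph.integrable_coboundary hν (measurable_comp_zero (g + κ))
    (fun _ => surprisal_nonneg p _ _) ((hW.integrable_iff g).mp hg)

lemma IsCohomologous.integrable_surprisal [IsFiniteMeasure ν]
    (hW : IsCohomologous ν W p P κ) (hν : MeasurePreserving shift ν ν) {g : V → ℝ}
    (hg : Integrable (fun ω : ℤ → V => Real.log (W (ω 0) (ω 1)) + g (ω 0) - g (ω 1)) ν) :
    Integrable (fun ω => surprisal p (ω 0) (ω 1)) ν := by
  refine ((hW.integrable_coboundary hν hg).sub ((hW.integrable_iff g).mp hg)).congr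
    (ae_of_all _ fun ω => ?_)
  exact sub_sub_cancel _ _

lemma IsCohomologous.integral_eq [IsProbabilityMeasure ν] (hW : IsCohomologous ν W p P κ)
    (hν : MeasurePreserving shift ν ν) {g : V → ℝ}
    (hg : Integrable (fun ω : ℤ → V => Real.log (W (ω 0) (ω 1)) + g (ω 0) - g (ω 1)) ν) :
    ∫ ω, (Real.log (W (ω 0) (ω 1)) + g (ω 0) - g (ω 1)) ∂ν = P - (crossEntropy p ν).toReal := by
  have hcob := hW.integrable_coboundary hν hg
  have hsur := hW.integrable_surprisal hν hg
  have hzero : ∫ ω : ℤ → V, ((g + κ) (ω 0) - (g + κ) (shift ω 0)) ∂ν = 0 :=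
    integral_coboundary_eq_zero hν (measurable_comp_zero (g + κ)) hcob
  have hdiff : Integrable (fun ω : ℤ → V =>
      ((g + κ) (ω 0) - (g + κ) (shift ω 0)) - surprisal p (ω 0) (ω 1)) ν := hcob.sub hsur
  rw [integral_congr_ae (hW.add_coboundary_ae_eq g),
    integral_add (integrable_const P) hdiff, integral_sub hcob hsur, hzero,
    integral_const, probReal_univ, one_smul, zero_sub, integral_surprisal_eq hsur, sub_eq_add_neg]

variable [Countable V]

lemma integrable_surprisal_iff :
    Integrable (fun ω => surprisal p (ω 0) (ω 1)) ν ↔ crossEntropy p ν ≠ ∞ := by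
  have hpair : Measurable fun ω : ℤ → V => (ω 0, ω 1) :=
    (measurable_pi_apply 0).prodMk (measurable_pi_apply 1)
  have hmeas : Measurable fun ω : ℤ → V => surprisal p (ω 0) (ω 1) :=
    (Measurable.of_discrete (f := Function.uncurry (surprisal p))).comp hpair
  rw [Integrable, hasFiniteIntegral_iff_ofReal (ae_of_all _ fun _ => surprisal_nonneg p _ _),
    lt_top_iff_ne_top, crossEntropy]
  exact and_iff_right hmeas.aestronglyMeasurable

lemma IsCohomologous.freeEnergy_eq_bot [IsFiniteMeasure ν]
    (hW : IsCohomologous ν W p P κ) (hν : MeasurePreserving shift ν ν)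
    (htop : crossEntropy p ν = ∞) : freeEnergy W ν = ⊥ := by
  simp only [freeEnergy, iSup_eq_bot]
  exact fun g hg => absurd htop (integrable_surprisal_iff.mp (hW.integrable_surprisal hν hg))

variable [IsProbabilityMeasure ν]

lemma IsCohomologous.freeEnergy_eq (hW : IsCohomologous ν W p P κ)
    (hν : MeasurePreserving shift ν ν) (hfin : crossEntropy p ν ≠ ∞) :
    freeEnergy W ν = (entropy ν : EReal) + ((P - (crossEntropy p ν).toReal : ℝ) : EReal) := by
  have hg : Integrable (fun ω : ℤ → V =>
      Real.log (W (ω 0) (ω 1)) + (-κ) (ω 0) - (-κ) (ω 1)) ν := by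
    rw [hW.integrable_iff (-κ)]
    simpa using (integrable_surprisal_iff.mpr hfin).neg
  refine le_antisymm (iSup₂_le fun g hg => by rw [hW.integral_eq hν hg]) ?_
  rw [← hW.integral_eq hν hg]
  exact le_iSup₂_of_le (-κ) hg le_rfl

lemma IsCohomologous.freeEnergy_eq_of_isMarkov (hW : IsCohomologous ν W p P κ)
    (hν : MeasurePreserving shift ν ν) (hfin : crossEntropy p ν ≠ ∞) (h : IsMarkov ν p) :
    freeEnergy W ν = P := by
  rw [hW.freeEnergy_eq hν hfin, entropy_eq_crossEntropy hν h, ← EReal.coe_ennreal_toReal hfin,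
    ← EReal.coe_add, add_sub_cancel]

lemma IsCohomologous.freeEnergy_le (hW : IsCohomologous ν W p P κ)
    (hν : MeasurePreserving shift ν ν)
    (hsupp : ∀ u : Fin 2 → V, lastProb p u = 0 → ν (cylinder u) = 0) :
    freeEnergy W ν ≤ P := by
  by_cases hfin : crossEntropy p ν = ∞
  · rw [hW.freeEnergy_eq_bot hν hfin]
    exact bot_le
  have hle : entropy ν ≤ crossEntropy p ν :=
    le_self_add.trans (entropy_add_lastRelEntropy_le hν hsupp)
  rw [hW.freeEnergy_eq hν hfin, ← EReal.coe_ennreal_toReal (ne_top_of_le_ne_top hfin hle),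
    ← EReal.coe_add, EReal.coe_le_coe_iff]
  linarith [ENNReal.toReal_mono hfin hle]

/-- The equality case of the variational principle: the relative entropies of all transitions fit
between the entropy and the cross entropy, so they vanish. -/
lemma IsCohomologous.isMarkov_of_le_freeEnergy (hW : IsCohomologous ν W p P κ)
    (hν : MeasurePreserving shift ν ν)
    (hsupp : ∀ (n : ℕ) (u : Fin (n + 2) → V), lastProb p u = 0 → ν (cylinder u) = 0)
    (hP : P ≤ freeEnergy W ν) : IsMarkov ν p := by
  have hfin : crossEntropy p ν ≠ ∞ := fun htop => EReal.coe_ne_bot P <|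
    le_bot_iff.mp (hP.trans_eq (hW.freeEnergy_eq_bot hν htop))
  have hent : entropy ν ≠ ∞ := ne_top_of_le_ne_top hfin
    (le_self_add.trans (entropy_add_lastRelEntropy_le hν (hsupp 0)))
  rw [hW.freeEnergy_eq hν hfin, ← EReal.coe_ennreal_toReal hent, ← EReal.coe_add,
    EReal.coe_le_coe_iff] at hP
  have hle : crossEntropy p ν ≤ entropy ν :=
    (ENNReal.toReal_le_toReal hfin hent).mp (by linarith)
  intro n
  refine (lastRelEntropy_eq_zero_iff (hsupp n)).mp (le_bot_iff.mp ?_)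
  refine (ENNReal.add_le_add_iff_left hent).mp ?_
  exact ((entropy_add_lastRelEntropy_le hν (hsupp n)).trans hle).trans_eq (add_zero _).symm

end FreeEnergy

/-! ### Positive recurrent matrices -/

section PositiveRecurrent

variable {V : Type*}

open Classical in
/-- Doob's `h`-transform of the matrix `B`: the Markov chain that moves from `i` to `j` with
probability `B i j * h j / h i`. It is meaningful for `h` harmonic and at points where `h` is
positive and finite; elsewhere the chain does not move. -/
def doobTransform (B : V → V → ℝ≥0∞) (h : V → ℝ≥0∞) (i : V) : PMF V :=
  if hi : ∑' j, B i j * h j ≠ 0 ∧ ∑' j, B i j * h j ≠ ∞ then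
    PMF.normalize (fun j => B i j * h j) hi.1 hi.2
  else PMF.pure i

lemma mul_doobTransform {B : V → V → ℝ≥0∞} {h : V → ℝ≥0∞} (hh : ∀ i, h i = ∑' j, B i j * h j)
    {i : V} (hi : h i ≠ ∞) (j : V) : h i * doobTransform B h i j = B i j * h j := by
  by_cases h0 : h i = 0
  · have hzero := hh i
    rw [h0, eq_comm, ENNReal.tsum_eq_zero] at hzero
    rw [h0, zero_mul, hzero j]
  · have hsum : ∑' j, B i j * h j ≠ 0 ∧ ∑' j, B i j * h j ≠ ∞ := by
      rw [← hh i]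
      exact ⟨h0, hi⟩
    rw [doobTransform, dif_pos hsum, PMF.normalize_apply, ← hh i, mul_left_comm,
      ENNReal.mul_inv_cancel h0 hi, mul_one]

lemma support_doobTransform_subset (B : V → V → ℝ≥0∞) (h : V → ℝ≥0∞) (i : V) :
    (doobTransform B h i).support ⊆ insert i {j | B i j ≠ 0} := by
  rw [doobTransform]
  split_ifs
  · intro j hj
    rw [PMF.mem_support_normalize_iff] at hj
    exact Or.inr (left_ne_zero_of_mul hj)
  · rw [PMF.support_pure]
    exact Set.singleton_subset_iff.mpr (Set.mem_insert i _)

lemma eq_of_le_of_tsum_le {f g : V → ℝ≥0∞} (hfg : f ≤ g) (hsum : ∑' i, g i ≤ ∑' i, f i)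
    (hf : ∑' i, f i ≠ ∞) : f = g :=
  le_antisymm hfg fun _ => not_lt.mp fun hlt =>
    hsum.not_gt (ENNReal.tsum_lt_tsum hf hfg hlt)

section Stationary

variable {p : V → PMF V} {v : V}

lemma eq_zero_of_reflTransGen {d : V → ℝ≥0∞} (hd : ∀ j, ∑' i, d i * p i j = d j) (hv : d v = 0)
    {i : V} (hi : Relation.ReflTransGen (fun i j => p i j ≠ 0) i v) : d i = 0 := by
  induction hi using Relation.ReflTransGen.head_induction_on with
  | refl => exact hv
  | @head i j hij _ ih =>
    rw [← hd j, ENNReal.tsum_eq_zero] at ih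
    exact (mul_eq_zero.mp (ih i)).resolve_right hij

lemma tsum_tsum_mul_pmf (p : V → PMF V) (d : V → ℝ≥0∞) :
    ∑' (j : V) (i : V), d i * p i j = ∑' i, d i := by
  rw [ENNReal.tsum_comm]
  simp_rw [ENNReal.tsum_mul_left, PMF.tsum_coe, mul_one]

variable {m π : PMF V}

lemma stationary_inf (hm : m.bind p = m) (hπ : π.bind p = π) (j : V) :
    ∑' i, (m i ⊓ π i) * p i j = m j ⊓ π j := by
  refine congrFun (eq_of_le_of_tsum_le (f := fun j => ∑' i, (m i ⊓ π i) * p i j)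
    (g := fun j => m j ⊓ π j) (fun j => ?_) (tsum_tsum_mul_pmf p _).ge ?_) j
  · refine le_inf ?_ ?_
    · conv_rhs => rw [← hm, PMF.bind_apply]
      exact ENNReal.tsum_le_tsum fun i => mul_le_mul_left inf_le_left _
    · conv_rhs => rw [← hπ, PMF.bind_apply]
      exact ENNReal.tsum_le_tsum fun i => mul_le_mul_left inf_le_right _
  · rw [tsum_tsum_mul_pmf]
    exact ne_top_of_le_ne_top m.tsum_coe_ne_top (ENNReal.tsum_le_tsum fun _ => inf_le_left)

lemma eq_of_stationary_of_le (hm : m.bind p = m) (hπ : π.bind p = π)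
    (hreach : ∀ i, m i ≠ 0 → Relation.ReflTransGen (fun i j => p i j ≠ 0) i v)
    (hv : m v ≤ π v) : m = π := by
  have hstat : ∀ j, ∑' i, (m i - m i ⊓ π i) * p i j = m j - m j ⊓ π j := fun j => by
    refine ENNReal.eq_sub_of_add_eq (ne_top_of_le_ne_top (m.apply_ne_top j) inf_le_left) ?_
    conv_rhs => rw [← hm, PMF.bind_apply]
    rw [← stationary_inf hm hπ, ← ENNReal.tsum_add]
    refine tsum_congr fun i => ?_
    rw [← add_mul, tsub_add_cancel_of_le inf_le_left]
  have hle : ∀ i, m i ≤ π i := fun i => by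
    by_cases hi : m i = 0
    · exact hi ▸ zero_le
    · have hzero := eq_zero_of_reflTransGen hstat (by rw [inf_eq_left.mpr hv, tsub_self])
        (hreach i hi)
      exact (tsub_eq_zero_iff_le.mp hzero).trans inf_le_right
  refine PMF.ext fun i => congrFun (eq_of_le_of_tsum_le hle ?_ m.tsum_coe_ne_top) i
  rw [m.tsum_coe, π.tsum_coe]

/-- The minimum of two stationary distributions is stationary, and so is the excess of each of them
over it. One of the two excesses vanishes at `v`, hence at every point from which `v` is reached. -/
lemma eq_of_stationary (hm : m.bind p = m) (hπ : π.bind p = π)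
    (hm' : ∀ i, m i ≠ 0 → Relation.ReflTransGen (fun i j => p i j ≠ 0) i v)
    (hπ' : ∀ i, π i ≠ 0 → Relation.ReflTransGen (fun i j => p i j ≠ 0) i v) : m = π :=
  (le_total (m v) (π v)).elim (eq_of_stationary_of_le hm hπ hm')
    fun h => (eq_of_stationary_of_le hπ hm hπ' h).symm

end Stationary

/-- The matrix `z A` is positive recurrent, as seen from `v`: the return time to `v` has total mass
`1` and finite mean, and the passage sums to `v` are finite. -/
structure IsPositiveRecurrent (A : V → V → ℝ≥0∞) (v : V) (z : ℝ≥0∞) : Prop where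
  hitSum_self : hitSum A v z v = 1
  hitSum_ne_top : ∀ i, hitSum A v z i ≠ ∞
  hitDeriv_ne_top : hitDeriv A v z v ≠ ∞

variable {A : V → V → ℝ≥0∞} {v : V} {z : ℝ≥0∞}

lemma ne_zero_of_hitSum_eq_one (h : hitSum A v z v = 1) : z ≠ 0 := by
  rintro rfl
  simp [hitSum] at h

lemma ne_top_of_hitSum_ne_top {i : V} (h0 : hitSum A v z i ≠ 0) (h : hitSum A v z i ≠ ∞) :
    z ≠ ∞ := by
  rintro rfl
  rw [hitSum, Ne, ENNReal.tsum_eq_zero, not_forall] at h0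
  obtain ⟨n, hn⟩ := h0
  refine ENNReal.ne_top_of_tsum_ne_top h n ?_
  rw [ENNReal.top_pow n.succ_ne_zero, ENNReal.mul_top (left_ne_zero_of_mul hn)]

lemma firstHit_ne_top (hz : z ≠ 0) {i : V} (h : hitSum A v z i ≠ ∞) (n : ℕ) :
    firstHit A v n i ≠ ∞ := fun hn =>
  ENNReal.ne_top_of_tsum_ne_top h n (by rw [hn, ENNReal.top_mul (pow_ne_zero _ hz)])

lemma hitSum_ne_zero_iff (hz : z ≠ 0) {i : V} :
    hitSum A v z i ≠ 0 ↔ ∃ n, firstHit A v n i ≠ 0 := by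
  simp [hitSum, hz]

lemma reflTransGen_of_firstHit_ne_zero (h : hitSum A v z v = 1) {n : ℕ} {i : V}
    (hi : firstHit A v n i ≠ 0) :
    Relation.ReflTransGen (fun i j => z * A i j * hitSum A v z j ≠ 0) i v := by
  have hz := ne_zero_of_hitSum_eq_one h
  induction n generalizing i with
  | zero =>
    refine .single ?_
    rw [h, mul_one]
    exact mul_ne_zero hz hi
  | succ n ih =>
    rw [firstHit, Ne, ENNReal.tsum_eq_zero, not_forall] at hi
    obtain ⟨j, hj⟩ := hi
    have hpos : A i j * firstHit A v n j ≠ 0 := fun h0 => hj (by rw [h0, ite_self])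
    refine .head ?_ (ih (right_ne_zero_of_mul hpos))
    exact mul_ne_zero (mul_ne_zero hz (left_ne_zero_of_mul hpos))
      ((hitSum_ne_zero_iff hz).mpr ⟨n, right_ne_zero_of_mul hpos⟩)

namespace IsPositiveRecurrent

variable (hA : IsPositiveRecurrent A v z)
include hA

lemma tsum_ne_zero : ∑' i, tabooSum A v z i * hitSum A v z i ≠ 0 := fun h0 => by
  have hv := ENNReal.tsum_eq_zero.mp h0 v
  rw [tabooSum_self, hA.hitSum_self, one_mul] at hv
  exact one_ne_zero hv

lemma tsum_ne_top : ∑' i, tabooSum A v z i * hitSum A v z i ≠ ∞ := by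
  rw [tsum_tabooSum_mul_hitSum]
  exact hA.hitDeriv_ne_top

omit hA in
variable (A v z) in
/-- The transition probabilities of the Markov chain of a recurrent matrix. -/
def chain : V → PMF V := doobTransform (fun i j => z * A i j) (hitSum A v z)

omit hA in
variable (A v z) in
/-- The transition probabilities of the time reversal of `chain`. -/
def reversedChain : V → PMF V := doobTransform (fun j i => z * A i j) (tabooSum A v z)

/-- The stationary distribution of `chain`. -/
def stationary : PMF V :=
  PMF.normalize (fun i => tabooSum A v z i * hitSum A v z i) hA.tsum_ne_zero hA.tsum_ne_top

lemma stationary_apply (i : V) :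
    hA.stationary i = tabooSum A v z i * hitSum A v z i * (hitDeriv A v z v)⁻¹ := by
  rw [stationary, PMF.normalize_apply, tsum_tabooSum_mul_hitSum]

lemma hitSum_mul_chain (i j : V) :
    hitSum A v z i * chain A v z i j = z * A i j * hitSum A v z j :=
  mul_doobTransform (hitSum_eq_tsum_of_eq_one hA.hitSum_self) (hA.hitSum_ne_top i) j

lemma tabooSum_mul_reversedChain {i j : V} (hj : hitSum A v z j ≠ 0) :
    tabooSum A v z j * reversedChain A v z j i = z * A i j * tabooSum A v z i := by
  refine mul_doobTransform (B := fun j i => z * A i j) (fun j => ?_) ?_ i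
  · rw [tabooSum_eq_tsum_of_eq_one hA.hitSum_self j]
    exact tsum_congr fun i => mul_comm _ _
  · exact fun htop => ENNReal.ne_top_of_tsum_ne_top hA.tsum_ne_top j
      (by rw [htop, ENNReal.top_mul hj])

lemma detailed_balance (i j : V) :
    hA.stationary i * chain A v z i j = hA.stationary j * reversedChain A v z j i := by
  have hforward := hA.hitSum_mul_chain i j
  rw [hA.stationary_apply, hA.stationary_apply]
  calc _ = tabooSum A v z i * (hitSum A v z i * chain A v z i j) * (hitDeriv A v z v)⁻¹ := by ring
    _ = (z * A i j * tabooSum A v z i) * hitSum A v z j * (hitDeriv A v z v)⁻¹ := by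
      rw [hforward]
      ring
    _ = _ := by
      by_cases hj : hitSum A v z j = 0
      · simp [hj]
      · rw [← hA.tabooSum_mul_reversedChain hj]
        ring

lemma bind_stationary_chain : hA.stationary.bind (chain A v z) = hA.stationary := by
  ext j
  simp_rw [PMF.bind_apply, hA.detailed_balance, ENNReal.tsum_mul_left, PMF.tsum_coe, mul_one]

lemma reflTransGen_chain {i : V} (hi : hitSum A v z i ≠ 0) :
    Relation.ReflTransGen (fun i j => chain A v z i j ≠ 0) i v := by
  obtain ⟨n, hn⟩ := (hitSum_ne_zero_iff (ne_zero_of_hitSum_eq_one hA.hitSum_self)).mp hi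
  refine (reflTransGen_of_firstHit_ne_zero hA.hitSum_self hn).lift id fun i j hij => ?_
  rw [← hA.hitSum_mul_chain] at hij
  exact right_ne_zero_of_mul hij

lemma eq_stationary {m : PMF V} (hm : m.bind (chain A v z) = m)
    (hm' : ∀ i, m i ≠ 0 → hitSum A v z i ≠ 0) : m = hA.stationary := by
  refine eq_of_stationary hm hA.bind_stationary_chain (fun i hi => hA.reflTransGen_chain (hm' i hi))
    fun i hi => hA.reflTransGen_chain ?_
  rw [hA.stationary_apply] at hi
  exact right_ne_zero_of_mul (left_ne_zero_of_mul hi)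

lemma stationary_mul_prod_chain {n : ℕ} (w : Fin (n + 1) → V) :
    hA.stationary (w 0) * ∏ i : Fin n, chain A v z (w i.castSucc) (w i.succ) =
      tabooSum A v z (w 0) * (∏ i : Fin n, z * A (w i.castSucc) (w i.succ)) *
        hitSum A v z (w (Fin.last n)) / hitDeriv A v z v := by
  have hprod : hitSum A v z (w 0) * ∏ i : Fin n, chain A v z (w i.castSucc) (w i.succ) =
      (∏ i : Fin n, z * A (w i.castSucc) (w i.succ)) * hitSum A v z (w (Fin.last n)) := by
    induction n with
    | zero => simp
    | succ n ih =>
      have hinit : hitSum A v z (w 0) *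
            ∏ i : Fin n, chain A v z (w i.castSucc.castSucc) (w i.castSucc.succ) =
          (∏ i : Fin n, z * A (w i.castSucc.castSucc) (w i.castSucc.succ)) *
            hitSum A v z (w (Fin.last n).castSucc) := ih (Fin.init w)
      rw [Fin.prod_univ_castSucc, Fin.prod_univ_castSucc, ← mul_assoc, hinit, mul_assoc,
        hA.hitSum_mul_chain, ← mul_assoc, Fin.succ_last]
  rw [hA.stationary_apply, div_eq_mul_inv, mul_assoc (tabooSum A v z (w 0)) (∏ i, _), ← hprod]
  ring

end IsPositiveRecurrent

end PositiveRecurrent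

/-! ### Equilibrium measures of positive recurrent loaded graphs -/

section Equilibrium

variable {V : Type*} [MeasurableSpace V]

lemma exists_mem_pathSpace {G : Digraph V} {ν : ProbabilityMeasure (ℤ → V)}
    (hν : ν ∈ invariantMeasures G) {s : Set (ℤ → V)} (hs : (ν : Measure (ℤ → V)) s ≠ 0) :
    ∃ ω ∈ s, ω ∈ pathSpace G :=
  ((frequently_ae_iff.mpr hs).and_eventually hν.2).exists

variable [Countable V]

lemma mem_invariantMeasures_of_cylinder {G : Digraph V} {μ : ProbabilityMeasure (ℤ → V)}
    (hμ : MeasurePreserving shift (μ : Measure (ℤ → V)) μ)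
    (h : ∀ i j, ¬ G.Adj i j → (μ : Measure (ℤ → V)) (cylinder ![i, j]) = 0) :
    μ ∈ invariantMeasures G := by
  have hadj : ∀ᵐ ω ∂(μ : Measure (ℤ → V)), G.Adj (ω 0) (ω 1) := by
    have hpair : ∀ i j, ∀ᵐ ω ∂(μ : Measure (ℤ → V)), ω ∈ cylinder ![i, j] → G.Adj i j := by
      intro i j
      by_cases hij : G.Adj i j
      · exact ae_of_all _ fun _ _ => hij
      · filter_upwards [measure_eq_zero_iff_ae_notMem.mp (h i j hij)] with ω hω hmem
        exact absurd hmem hω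
    filter_upwards [ae_all_iff.mpr fun i => ae_all_iff.mpr (hpair i)] with ω hω
    exact hω (ω 0) (ω 1) (Fin.forall_fin_two.mpr ⟨rfl, rfl⟩)
  refine ⟨hμ, ae_all_iff.mpr fun k => ?_⟩
  filter_upwards [(measurePreserving_shiftBy hμ k).quasiMeasurePreserving.ae hadj] with ω hω
  simpa [shiftBy, add_comm] using hω

omit [MeasurableSpace V] [Countable V] in
lemma ofReal_surprisal_mul_le (p : V → PMF V) (i j : V) :
    ENNReal.ofReal (surprisal p i j) * p i j ≤ (p i).support.indicator 1 j := by
  by_cases hj : p i j = 0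
  · simp [hj]
  · rw [Set.indicator_of_mem (((p i).mem_support_iff j).mpr hj), Pi.one_apply]
    calc ENNReal.ofReal (surprisal p i j) * p i j
        = ENNReal.ofReal (Real.negMulLog (p i j).toReal) := by
          rw [surprisal, Real.negMulLog, neg_mul_comm, mul_comm, ← ENNReal.ofReal_toReal
            ((p i).apply_ne_top j), ← ENNReal.ofReal_mul ENNReal.toReal_nonneg,
            ENNReal.toReal_ofReal ENNReal.toReal_nonneg]
      _ ≤ ENNReal.ofReal 1 := ENNReal.ofReal_le_ofReal <|
        (Real.negMulLog_le_one_sub_self ENNReal.toReal_nonneg).trans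
          (sub_le_self 1 ENNReal.toReal_nonneg)
      _ = 1 := ENNReal.ofReal_one

section Markov

variable [DiscreteMeasurableSpace V] {ν : Measure (ℤ → V)} [IsProbabilityMeasure ν] {p : V → PMF V}

lemma IsMarkov.measure_cylinder_pair (h : IsMarkov ν p) (i j : V) :
    ν (cylinder ![i, j]) = marginal ν i * p i j := by
  rw [h 0, cylinder_fin_one, marginal_apply]
  rfl

lemma IsMarkov.crossEntropy_le (h : IsMarkov ν p) {N : ℕ∞}
    (hN : ∀ i, (p i).support.encard ≤ N) : crossEntropy p ν ≤ N := by
  have hterm : ∀ i j, ENNReal.ofReal (surprisal p i j) * ν (cylinder ![i, j]) ≤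
      marginal ν i * (p i).support.indicator 1 j := fun i j => by
    rw [h.measure_cylinder_pair, mul_left_comm]
    exact mul_le_mul_right (ofReal_surprisal_mul_le p i j) _
  calc crossEntropy p ν
      = ∑' u : Fin 2 → V, ENNReal.ofReal (surprisal p (u 0) (u 1)) * ν (cylinder u) :=
        (tsum_mul_cylinder ν 2 fun u => ENNReal.ofReal (surprisal p (u 0) (u 1))).symm
    _ = ∑' (i : V) (j : V), ENNReal.ofReal (surprisal p i j) * ν (cylinder ![i, j]) := by
        rw [← (finTwoArrowEquiv V).symm.tsum_eq, ENNReal.tsum_prod']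
        rfl
    _ ≤ ∑' (i : V) (j : V), marginal ν i * (p i).support.indicator 1 j :=
        ENNReal.tsum_le_tsum fun i => ENNReal.tsum_le_tsum (hterm i)
    _ = ∑' i, marginal ν i * (p i).support.encard := by
        simp_rw [ENNReal.tsum_mul_left, ← tsum_subtype, Pi.one_apply, ENNReal.tsum_set_one]
    _ ≤ ∑' i, marginal ν i * N := by
        gcongr
        exact hN _
    _ = N := by rw [ENNReal.tsum_mul_right, PMF.tsum_coe, one_mul]

lemma IsMarkov.bind_marginal (hν : MeasurePreserving shift ν ν) (h : IsMarkov ν p) :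
    (marginal ν).bind p = marginal ν := by
  ext j
  simp_rw [PMF.bind_apply, ← h.measure_cylinder_pair, ← measure_coord_one_eq_marginal hν]
  rw [← measure_iUnion _ fun i => measurableSet_cylinder _]
  · congr 1
    ext ω
    simp [cylinder, Fin.forall_fin_two]
  · intro a b hab
    exact Set.disjoint_left.mpr fun ω ha hb => hab ((ha 0).symm.trans (hb 0))

lemma IsMarkov.eq_of_marginal_eq {μ ν : ProbabilityMeasure (ℤ → V)}
    (hμ : MeasurePreserving shift (μ : Measure (ℤ → V)) μ)
    (hν : MeasurePreserving shift (ν : Measure (ℤ → V)) ν)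
    (hμp : IsMarkov (μ : Measure (ℤ → V)) p) (hνp : IsMarkov (ν : Measure (ℤ → V)) p)
    (h : marginal (μ : Measure (ℤ → V)) = marginal (ν : Measure (ℤ → V))) : μ = ν := by
  refine ProbabilityMeasure.toMeasure_injective (ext_of_cylinder hμ hν fun n w => ?_)
  induction n with
  | zero => rw [cylinder_fin_one, ← marginal_apply, ← marginal_apply, h]
  | succ n ih => rw [hμp, hνp, ih]

end Markov

variable [DiscreteMeasurableSpace V]

namespace IsPositiveRecurrent

section Matrix

variable {A : V → V → ℝ≥0∞} {v : V} {z : ℝ≥0∞} (hA : IsPositiveRecurrent A v z)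
include hA

/-- The stationary Markov measure of a positive recurrent matrix. -/
def equilibrium : ProbabilityMeasure (ℤ → V) :=
  markovMeasure hA.stationary (chain A v z) (reversedChain A v z)

lemma measurePreserving_equilibrium :
    MeasurePreserving shift (hA.equilibrium : Measure (ℤ → V)) hA.equilibrium :=
  measurePreserving_shift_markovMeasure hA.detailed_balance

lemma equilibrium_cylinder {n : ℕ} (w : Fin (n + 1) → V) :
    (hA.equilibrium : Measure (ℤ → V)) (cylinder w) =
      tabooSum A v z (w 0) * (∏ i : Fin n, z * A (w i.castSucc) (w i.succ)) *
        hitSum A v z (w (Fin.last n)) / hitDeriv A v z v := by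
  rw [← hA.stationary_mul_prod_chain]
  exact markovMeasure_cylinder hA.detailed_balance w

lemma isMarkov_equilibrium : IsMarkov (hA.equilibrium : Measure (ℤ → V)) (chain A v z) := by
  intro n u
  simp only [equilibrium, markovMeasure_cylinder hA.detailed_balance]
  rw [Fin.prod_univ_castSucc, ← mul_assoc]
  rfl

lemma marginal_equilibrium : marginal (hA.equilibrium : Measure (ℤ → V)) = hA.stationary := by
  ext i
  have hcyl := markovMeasure_cylinder hA.detailed_balance ![i]
  rw [cylinder_fin_one] at hcyl
  rw [marginal_apply, equilibrium]
  simpa using hcyl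

end Matrix

omit [MeasurableSpace V] [DiscreteMeasurableSpace V] [Countable V] in
lemma support_chain_subset (G : Digraph V) (W : V → V → ℝ≥0) (v : V) (z : ℝ≥0∞) (i : V) :
    (chain (edgeWeight G W) v z i).support ⊆ insert i {j | G.Adj i j} := by
  refine (support_doobTransform_subset _ _ i).trans (Set.insert_subset_insert fun j hj => ?_)
  exact adj_of_edgeWeight_ne_zero (right_ne_zero_of_mul hj)

variable {G : Digraph V} {W : V → V → ℝ≥0} {v : V} {z : ℝ≥0∞}
  (hA : IsPositiveRecurrent (edgeWeight G W) v z)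
include hA

lemma equilibrium_mem_invariantMeasures : hA.equilibrium ∈ invariantMeasures G := by
  refine mem_invariantMeasures_of_cylinder hA.measurePreserving_equilibrium fun i j hij => ?_
  simp [hA.equilibrium_cylinder, edgeWeight, hij]

lemma crossEntropy_equilibrium_ne_top {N : ℕ} (hdeg : ∀ i, {j | G.Adj i j}.encard ≤ N) :
    crossEntropy (chain (edgeWeight G W) v z) (hA.equilibrium : Measure (ℤ → V)) ≠ ∞ := by
  refine ne_top_of_le_ne_top (b := ((N + 1 : ℕ∞) : ℝ≥0∞)) (by simp)
    (hA.isMarkov_equilibrium.crossEntropy_le fun i => ?_)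
  exact (Set.encard_le_encard (support_chain_subset G W v z i)).trans
    ((Set.encard_insert_le _ i).trans (by gcongr; exact hdeg i))

variable (hW : ∀ i j, G.Adj i j → 0 < W i j)
  (hpos : ∀ i j, G.Adj i j → hitSum (edgeWeight G W) v z i ≠ 0)
include hW hpos

omit [MeasurableSpace V] [DiscreteMeasurableSpace V] [Countable V] in
lemma chain_ne_zero_of_mem_pathSpace {ω : ℤ → V} (hω : ω ∈ pathSpace G) (k : ℤ) :
    chain (edgeWeight G W) v z (ω k) (ω (k + 1)) ≠ 0 := by
  refine right_ne_zero_of_mul (a := hitSum (edgeWeight G W) v z (ω k)) ?_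
  rw [hA.hitSum_mul_chain, edgeWeight, if_pos (hω k)]
  exact mul_ne_zero (mul_ne_zero (ne_zero_of_hitSum_eq_one hA.hitSum_self)
    (ENNReal.coe_ne_zero.mpr (hW _ _ (hω k)).ne')) (hpos _ _ (hω (k + 1)))

variable {ν : ProbabilityMeasure (ℤ → V)} (hν : ν ∈ invariantMeasures G)
include hν

omit [DiscreteMeasurableSpace V] [Countable V] in
lemma measure_cylinder_eq_zero {n : ℕ} (u : Fin (n + 2) → V)
    (hu : lastProb (chain (edgeWeight G W) v z) u = 0) :
    (ν : Measure (ℤ → V)) (cylinder u) = 0 := by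
  by_contra hne
  obtain ⟨ω, hω, hpath⟩ := exists_mem_pathSpace hν hne
  refine hA.chain_ne_zero_of_mem_pathSpace hW hpos hpath n ?_
  rw [← hu, lastProb, ← hω, ← hω]
  simp

omit [DiscreteMeasurableSpace V] [Countable V] in
lemma isCohomologous : IsCohomologous (ν : Measure (ℤ → V)) W (chain (edgeWeight G W) v z)
    (-Real.log z.toReal) fun i => Real.log (hitSum (edgeWeight G W) v z i).toReal := by
  filter_upwards [hν.2] with ω hω
  have hadj := hω 0
  rw [zero_add] at hadj
  have hz : z.toReal ≠ 0 := ENNReal.toReal_ne_zero.mpr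
    ⟨ne_zero_of_hitSum_eq_one hA.hitSum_self,
      ne_top_of_hitSum_ne_top (hpos _ _ hadj) (hA.hitSum_ne_top _)⟩
  have hhit : ∀ k, (hitSum (edgeWeight G W) v z (ω k)).toReal ≠ 0 := fun k =>
    ENNReal.toReal_ne_zero.mpr ⟨hpos _ _ (hω k), hA.hitSum_ne_top _⟩
  have hp : (chain (edgeWeight G W) v z (ω 0) (ω 1)).toReal ≠ 0 := ENNReal.toReal_ne_zero.mpr
    ⟨by simpa using hA.chain_ne_zero_of_mem_pathSpace hW hpos hω 0, PMF.apply_ne_top _ _⟩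
  have hWne : (W (ω 0) (ω 1) : ℝ) ≠ 0 := NNReal.coe_ne_zero.mpr (hW _ _ hadj).ne'
  have hmul := congrArg (fun x => Real.log x.toReal) (hA.hitSum_mul_chain (ω 0) (ω 1))
  simp only [ENNReal.toReal_mul, edgeWeight, if_pos hadj, ENNReal.coe_toReal] at hmul
  rw [Real.log_mul (hhit 0) hp, Real.log_mul (mul_ne_zero hz hWne) (hhit 1),
    Real.log_mul hz hWne] at hmul
  rw [surprisal]
  linarith

lemma freeEnergy_le : freeEnergy W (ν : Measure (ℤ → V)) ≤ ((-Real.log z.toReal : ℝ) : EReal) :=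
  (hA.isCohomologous hW hpos hν).freeEnergy_le hν.1 (hA.measure_cylinder_eq_zero hW hpos hν)

lemma eq_equilibrium_of_le_freeEnergy
    (h : ((-Real.log z.toReal : ℝ) : EReal) ≤ freeEnergy W (ν : Measure (ℤ → V))) :
    ν = hA.equilibrium := by
  have hmarkov : IsMarkov (ν : Measure (ℤ → V)) (chain (edgeWeight G W) v z) :=
    (hA.isCohomologous hW hpos hν).isMarkov_of_le_freeEnergy hν.1
      (fun _ => hA.measure_cylinder_eq_zero hW hpos hν) h
  refine hmarkov.eq_of_marginal_eq hν.1 hA.measurePreserving_equilibrium hA.isMarkov_equilibrium ?_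
  rw [hA.marginal_equilibrium]
  refine hA.eq_stationary (hmarkov.bind_marginal hν.1) fun i hi => ?_
  rw [marginal_apply] at hi
  obtain ⟨ω, rfl, hpath⟩ := exists_mem_pathSpace hν hi
  exact hpos _ _ (hpath 0)

omit hν in
lemma freeEnergy_equilibrium {N : ℕ} (hdeg : ∀ i, {j | G.Adj i j}.encard ≤ N) :
    freeEnergy W (hA.equilibrium : Measure (ℤ → V)) = ((-Real.log z.toReal : ℝ) : EReal) :=
  (hA.isCohomologous hW hpos hA.equilibrium_mem_invariantMeasures).freeEnergy_eq_of_isMarkov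
    hA.measurePreserving_equilibrium (hA.crossEntropy_equilibrium_ne_top hdeg)
    hA.isMarkov_equilibrium

omit hν in
theorem isEquilibriumMeasure_iff {N : ℕ} (hdeg : ∀ i, {j | G.Adj i j}.encard ≤ N) :
    IsEquilibriumMeasure G W ν ↔ ν = hA.equilibrium := by
  have hfree := hA.freeEnergy_equilibrium hW hpos hdeg
  have hmem := hA.equilibrium_mem_invariantMeasures
  constructor
  · rintro ⟨hν, hmax⟩
    exact hA.eq_equilibrium_of_le_freeEnergy hW hpos hν (hfree.symm.trans_le (hmax _ hmem))
  · rintro rfl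
    exact ⟨hmem, fun ν hν => (hA.freeEnergy_le hW hpos hν).trans_eq hfree.symm⟩

end IsPositiveRecurrent

end Equilibrium

/-! ### Change of the base vertex -/

section Solidarity

variable {V : Type*}

open Classical in
/-- The weight matrix without the edges that end at `b`: its first passage sums count the paths that
do not go through `b`, except possibly at their start. -/
def avoiding (A : V → V → ℝ≥0∞) (b i j : V) : ℝ≥0∞ :=
  if j = b then 0 else A i j

variable {A : V → V → ℝ≥0∞} {a b v : V} {x z ρ : ℝ≥0∞}

open Classical in
lemma firstHit_avoiding_succ (n : ℕ) (i : V) :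
    firstHit (avoiding A b) a (n + 1) i =
      ∑' j, if j = a ∨ j = b then 0 else A i j * firstHit (avoiding A b) a n j := by
  rw [firstHit]
  refine tsum_congr fun j => ?_
  by_cases ha : j = a <;> by_cases hb : j = b <;> simp [ha, hb, avoiding]

open Classical in
lemma firstHit_succ_eq_mul_add (hab : a ≠ b) (n : ℕ) (i : V) :
    firstHit A a (n + 1) i =
      A i b * firstHit A a n b + ∑' j, if j = a ∨ j = b then 0 else A i j * firstHit A a n j := by
  rw [firstHit, ENNReal.tsum_eq_add_tsum_ite b, if_neg hab.symm]
  congr 1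
  refine tsum_congr fun j => ?_
  by_cases ha : j = a <;> by_cases hb : j = b <;> simp [ha, hb]

-- The sum runs over the position of the first passage through `b`.
lemma firstHit_succ_eq_add_sum (hab : a ≠ b) (n : ℕ) (i : V) :
    firstHit A a (n + 1) i = firstHit (avoiding A b) a (n + 1) i +
      ∑ p ∈ Finset.HasAntidiagonal.antidiagonal n,
        firstHit (avoiding A a) b p.1 i * firstHit A a p.2 b := by
  classical
  have hstart (i : V) : firstHit (avoiding A a) b 0 i = A i b := by
    simp [firstHit, avoiding, hab.symm]
  induction n generalizing i with
  | zero =>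
    rw [firstHit_succ_eq_mul_add hab, firstHit_avoiding_succ, add_comm]
    simp [hab.symm, firstHit, avoiding, hab]
  | succ n ih =>
    rw [firstHit_succ_eq_mul_add hab, firstHit_avoiding_succ, Finset.Nat.sum_antidiagonal_succ,
      hstart]
    simp_rw [firstHit_avoiding_succ, ← ENNReal.tsum_mul_right]
    rw [← Summable.tsum_finsetSum fun _ _ => ENNReal.summable, add_left_comm, ← ENNReal.tsum_add]
    congr 1
    refine tsum_congr fun j => ?_
    by_cases hj : j = a ∨ j = b
    · simp [hj, hj.symm]
    · simp [hj, or_comm (a := j = b), ih, firstHit_avoiding_succ, mul_add, Finset.mul_sum,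
        mul_assoc]

lemma tsum_mul_firstHit_eq_add (hab : a ≠ b) (w : ℕ → ℝ≥0∞) (i : V) :
    ∑' n, w n * firstHit A a n i = ∑' n, w n * firstHit (avoiding A b) a n i +
      ∑' (k : ℕ) (m : ℕ), w (k + m + 1) * (firstHit (avoiding A a) b k i * firstHit A a m b) := by
  have hzero : firstHit (avoiding A b) a 0 i = firstHit A a 0 i := by
    simp [firstHit, avoiding, hab]
  rw [tsum_eq_zero_add' ENNReal.summable,
    tsum_eq_zero_add' (f := fun n => w n * firstHit (avoiding A b) a n i) ENNReal.summable, hzero,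
    tsum_tsum_eq_tsum_sum_antidiagonal fun k m =>
      w (k + m + 1) * (firstHit (avoiding A a) b k i * firstHit A a m b),
    add_assoc, ← ENNReal.tsum_add]
  congr 1
  refine tsum_congr fun n => ?_
  rw [firstHit_succ_eq_add_sum hab, mul_add, Finset.mul_sum]
  congr 1
  refine Finset.sum_congr rfl fun p hp => ?_
  rw [Finset.HasAntidiagonal.mem_antidiagonal.mp hp]

lemma hitSum_eq_add (hab : a ≠ b) (z : ℝ≥0∞) (i : V) :
    hitSum A a z i = hitSum (avoiding A b) a z i +
      hitSum (avoiding A a) b z i * hitSum A a z b := by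
  simp_rw [hitSum, mul_comm _ (z ^ _), ← ENNReal.tsum_mul_right, ← ENNReal.tsum_mul_left]
  rw [tsum_mul_firstHit_eq_add hab]
  congr 1
  refine tsum_congr fun k => tsum_congr fun m => ?_
  ring

lemma hitDeriv_eq_add (hab : a ≠ b) (z : ℝ≥0∞) (i : V) :
    hitDeriv A a z i = hitDeriv (avoiding A b) a z i +
      (hitDeriv (avoiding A a) b z i * hitSum A a z b +
        hitSum (avoiding A a) b z i * hitDeriv A a z b) := by
  simp_rw [hitDeriv, hitSum, mul_comm _ (z ^ _), ← mul_assoc, ← ENNReal.tsum_mul_right]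
  simp_rw [← ENNReal.tsum_mul_left]
  rw [tsum_mul_firstHit_eq_add hab]
  congr 1
  rw [← ENNReal.tsum_add]
  refine tsum_congr fun k => ?_
  rw [← ENNReal.tsum_add]
  refine tsum_congr fun m => ?_
  push_cast
  ring

lemma hitSum_mono (A : V → V → ℝ≥0∞) (v i : V) : Monotone fun z => hitSum A v z i :=
  fun _ _ h => ENNReal.tsum_le_tsum fun n => by gcongr

lemma hitSum_convex_le (A : V → V → ℝ≥0∞) (v i : V) {s t : ℝ≥0∞} (hst : s + t = 1)
    (x y : ℝ≥0∞) : hitSum A v (s * x + t * y) i ≤ s * hitSum A v x i + t * hitSum A v y i := by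
  simp_rw [hitSum, ← ENNReal.tsum_mul_left]
  rw [← ENNReal.tsum_add]
  refine ENNReal.tsum_le_tsum fun n => ?_
  have hpow : (s * x + t * y) ^ (n + 1) ≤ s * x ^ (n + 1) + t * y ^ (n + 1) := by
    have h := ENNReal.rpow_arith_mean_le_arith_mean2_rpow s t x y hst
      (p := ((n + 1 : ℕ) : ℝ)) (by simp)
    simpa only [ENNReal.rpow_natCast] using h
  calc firstHit A v n i * (s * x + t * y) ^ (n + 1)
    _ ≤ firstHit A v n i * (s * x ^ (n + 1) + t * y ^ (n + 1)) := by gcongr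
    _ = _ := by ring

lemma exists_gt_hitSum_lt {i : V} {c : ℝ≥0∞} (hρz : ρ < z) (hρ : hitSum A v ρ i < c)
    (hz : hitSum A v z i ≠ ∞) : ∃ x, ρ < x ∧ x ≤ z ∧ hitSum A v x i < c := by
  have hlim : Tendsto (fun t => hitSum A v ρ i + t * hitSum A v z i) (𝓝 0)
      (𝓝 (hitSum A v ρ i)) := by
    simpa using (ENNReal.Tendsto.mul_const (tendsto_id (x := 𝓝 0)) (Or.inr hz)).const_add
      (hitSum A v ρ i)
  obtain ⟨t, ht0, ht⟩ := (ENNReal.nhds_zero_basis_Iic).eventually_iff.mp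
    ((hlim.eventually (gt_mem_nhds hρ)).and (ge_mem_nhds (zero_lt_one : (0 : ℝ≥0∞) < 1)))
  obtain ⟨hlt, ht1⟩ := ht (Set.mem_Iic.mpr le_rfl)
  have hst : 1 - t + t = 1 := tsub_add_cancel_of_le ht1
  refine ⟨(1 - t) * ρ + t * z, ?_, ?_, ?_⟩
  · calc ρ = (1 - t) * ρ + t * ρ := by rw [← add_mul, hst, one_mul]
      _ < (1 - t) * ρ + t * z := ENNReal.add_lt_add_left
        (ENNReal.mul_ne_top (by finiteness) hρz.ne_top)
        (ENNReal.mul_lt_mul_right ht0.ne' (ne_top_of_le_ne_top ENNReal.one_ne_top ht1) hρz)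
  · calc (1 - t) * ρ + t * z ≤ (1 - t) * z + t * z := by gcongr
      _ = z := by rw [← add_mul, hst, one_mul]
  · refine (hitSum_convex_le A v i hst ρ z).trans_lt (lt_of_le_of_lt ?_ hlt)
    gcongr
    exact mul_le_of_le_one_left zero_le tsub_le_self

-- The equation `y = f + a y` for `y = hitSum A a z b` does not exclude `y = ∞`; its analogue for
-- the finite partial sums of `y` does.
lemma hitSum_le_div (hab : a ≠ b) (hfin : ∀ n, firstHit A a n b ≠ ∞) (hz : z ≠ ∞)
    (hlt : hitSum (avoiding A a) b z b < 1) :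
    hitSum A a z b ≤ hitSum (avoiding A b) a z b / (1 - hitSum (avoiding A a) b z b) := by
  rw [hitSum]
  refine ENNReal.tsum_le_of_sum_range_le fun N => ?_
  let w : ℕ → ℝ≥0∞ := fun n => if n < N then z ^ (n + 1) else 0
  have hw (n : ℕ) : w n ≤ z ^ (n + 1) := by
    simp only [w]
    split_ifs <;> simp
  have hw_add (k m : ℕ) : w (k + m + 1) ≤ z ^ (k + 1) * w m := by
    simp only [w]
    split_ifs
    · exact le_of_eq (by ring)
    · omega
    · simp
    · simp
  set S := ∑ n ∈ Finset.range N, firstHit A a n b * z ^ (n + 1)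
  have hS : S = ∑' n, w n * firstHit A a n b := by
    rw [tsum_eq_sum (s := Finset.range N) fun n hn => by simp_all [w]]
    exact Finset.sum_congr rfl fun n hn => by simp [w, Finset.mem_range.mp hn, mul_comm]
  have hS_ne_top : S ≠ ∞ :=
    ENNReal.sum_ne_top.mpr fun n _ => ENNReal.mul_ne_top (hfin n) (ENNReal.pow_ne_top hz)
  have hrenewal : S ≤ hitSum (avoiding A b) a z b + hitSum (avoiding A a) b z b * S := by
    nth_rw 1 [hS]
    rw [tsum_mul_firstHit_eq_add hab, hS]
    simp_rw [hitSum, ← ENNReal.tsum_mul_right, ← ENNReal.tsum_mul_left]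
    refine add_le_add (ENNReal.tsum_le_tsum fun n => ?_)
      (ENNReal.tsum_le_tsum fun k => ENNReal.tsum_le_tsum fun m => ?_)
    · rw [mul_comm]
      gcongr
      exact hw n
    · calc _ ≤ z ^ (k + 1) * w m * (firstHit (avoiding A a) b k b * firstHit A a m b) := by
            gcongr
            exact hw_add k m
        _ = _ := by ring
  rw [ENNReal.le_div_iff_mul_le (Or.inl (tsub_pos_of_lt hlt).ne') (Or.inl (by finiteness)),
    ENNReal.mul_sub fun _ _ => hS_ne_top, mul_one, tsub_le_iff_right, mul_comm S]
  exact hrenewal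

lemma firstHit_eq_zero_of_avoiding (hab : a ≠ b)
    (h : ∀ n, firstHit (avoiding A b) a n b = 0) (n : ℕ) : firstHit A a n b = 0 := by
  induction n using Nat.strong_induction_on with
  | _ n ih =>
    cases n with
    | zero => simpa [firstHit, avoiding, hab] using h 0
    | succ n =>
      rw [firstHit_succ_eq_add_sum hab, h, zero_add]
      refine Finset.sum_eq_zero fun p hp => ?_
      rw [ih p.2 (Nat.lt_succ_of_le (Finset.HasAntidiagonal.antidiagonal.snd_le hp)), mul_zero]

lemma hitSum_avoiding_ne_zero (hab : a ≠ b) (hz : z ≠ 0) (h : hitSum A a z b ≠ 0) :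
    hitSum (avoiding A b) a z b ≠ 0 := by
  rw [hitSum_ne_zero_iff hz] at h ⊢
  contrapose! h
  exact firstHit_eq_zero_of_avoiding hab h

section CyclesThroughBase

variable (hvb : v ≠ b) (hcycle : ∀ n, firstHit (avoiding A b) v n v = 0)

include hvb hcycle

lemma hitSum_self_eq_mul (z : ℝ≥0∞) :
    hitSum A v z v = hitSum (avoiding A v) b z v * hitSum A v z b := by
  rw [hitSum_eq_add hvb]
  simp [hitSum, hcycle]

lemma hitSum_eq_hitSum_avoiding (z : ℝ≥0∞) : hitSum A b z v = hitSum (avoiding A v) b z v := by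
  rw [hitSum_eq_add hvb.symm, hitSum.eq_def (avoiding A b)]
  simp [hcycle]

lemma hitSum_base_eq_add (z : ℝ≥0∞) :
    hitSum A b z b = hitSum (avoiding A v) b z b +
      hitSum (avoiding A b) v z b * hitSum (avoiding A v) b z v := by
  rw [hitSum_eq_add hvb.symm, hitSum_eq_hitSum_avoiding hvb hcycle]

lemma hitDeriv_self_eq_add (z : ℝ≥0∞) :
    hitDeriv A v z v = hitDeriv (avoiding A v) b z v * hitSum A v z b +
      hitSum (avoiding A v) b z v * hitDeriv A v z b := by
  rw [hitDeriv_eq_add hvb, hitDeriv]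
  simp [hcycle]

lemma hitDeriv_eq_hitDeriv_avoiding (z : ℝ≥0∞) :
    hitDeriv A b z v = hitDeriv (avoiding A v) b z v := by
  rw [hitDeriv_eq_add hvb.symm, hitDeriv.eq_def (avoiding A b), hitSum.eq_def (avoiding A b)]
  simp [hcycle]

lemma hitSum_base_eq_one (h : hitSum A v z v = 1) : hitSum A b z b = 1 := by
  have hmul := hitSum_self_eq_mul hvb hcycle z
  rw [h] at hmul
  calc hitSum A b z b
    _ = hitSum (avoiding A v) b z b * (hitSum (avoiding A v) b z v * hitSum A v z b) +
        hitSum (avoiding A b) v z b * hitSum (avoiding A v) b z v := by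
      rw [hitSum_base_eq_add hvb hcycle, ← hmul, mul_one]
    _ = hitSum (avoiding A v) b z v *
        (hitSum (avoiding A b) v z b + hitSum (avoiding A v) b z b * hitSum A v z b) := by ring
    _ = 1 := by rw [← hitSum_eq_add hvb, ← hmul]

lemma hitSum_factors_ne_zero (h : hitSum A v z v = 1) :
    hitSum (avoiding A v) b z v ≠ 0 ∧ hitSum A v z b ≠ 0 ∧ hitSum (avoiding A b) v z b ≠ 0 := by
  have hmul : hitSum (avoiding A v) b z v * hitSum A v z b ≠ 0 := by
    rw [← hitSum_self_eq_mul hvb hcycle, h]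
    exact one_ne_zero
  exact ⟨left_ne_zero_of_mul hmul, right_ne_zero_of_mul hmul,
    hitSum_avoiding_ne_zero hvb (ne_zero_of_hitSum_eq_one h) (right_ne_zero_of_mul hmul)⟩

lemma hitDeriv_base_ne_top (h : hitSum A v z v = 1) (hD : hitDeriv A v z v ≠ ∞) :
    hitDeriv A b z b ≠ ∞ := by
  obtain ⟨hg0, hy0, hf0⟩ := hitSum_factors_ne_zero hvb hcycle h
  rw [hitDeriv_self_eq_add hvb hcycle, ENNReal.add_ne_top] at hD
  have hDg := ENNReal.lt_top_of_mul_ne_top_left hD.1 hy0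
  have hDy := (ENNReal.lt_top_of_mul_ne_top_right hD.2 hg0).ne
  rw [hitDeriv_eq_add hvb, ENNReal.add_ne_top, ENNReal.add_ne_top] at hDy
  obtain ⟨hDf, hDa, -⟩ := hDy
  have hfg : hitSum (avoiding A b) v z b * hitSum (avoiding A v) b z v ≠ ∞ := by
    refine ne_top_of_le_ne_top ENNReal.one_ne_top ?_
    rw [← hitSum_base_eq_one hvb hcycle h, hitSum_base_eq_add hvb hcycle]
    exact le_add_self
  rw [hitDeriv_eq_add hvb.symm, hitSum_eq_hitSum_avoiding hvb hcycle,
    hitDeriv_eq_hitDeriv_avoiding hvb hcycle]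
  exact ENNReal.add_ne_top.mpr ⟨(ENNReal.lt_top_of_mul_ne_top_left hDa hy0).ne,
    ENNReal.add_ne_top.mpr
      ⟨ENNReal.mul_ne_top hDf (ENNReal.lt_top_of_mul_ne_top_right hfg hf0).ne,
        ENNReal.mul_ne_top (ENNReal.lt_top_of_mul_ne_top_left hfg hg0).ne hDg.ne⟩⟩

lemma exists_gt_hitSum_self_ne_top (h : hitSum A v ρ v = 1) (hρz : ρ < z)
    (hz : hitSum A b z b ≠ ∞) : ∃ x, ρ < x ∧ hitSum A v x v ≠ ∞ := by
  obtain ⟨hg0, hy0, hf0⟩ := hitSum_factors_ne_zero hvb hcycle h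
  have hρ0 := ne_zero_of_hitSum_eq_one h
  have hg0z := hg0.bot_lt.trans_le (hitSum_mono (avoiding A v) b v hρz.le)
  have hf0z := hf0.bot_lt.trans_le (hitSum_mono (avoiding A b) v b hρz.le)
  rw [hitSum_base_eq_add hvb hcycle, ENNReal.add_ne_top] at hz
  have hf := (ENNReal.lt_top_of_mul_ne_top_left hz.2 hg0z.ne').ne
  have hg := (ENNReal.lt_top_of_mul_ne_top_right hz.2 hf0z.ne').ne
  have ha : hitSum (avoiding A v) b ρ b < 1 := by
    rw [← hitSum_base_eq_one hvb hcycle h, hitSum_base_eq_add hvb hcycle]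
    exact ENNReal.lt_add_right (ne_top_of_le_ne_top hz.1 (hitSum_mono _ _ _ hρz.le))
      (mul_ne_zero hf0 hg0)
  obtain ⟨x, hρx, hxz, hx⟩ := exists_gt_hitSum_lt hρz ha hz.1
  have hy : hitSum A v ρ b ≠ ∞ := by
    refine (ENNReal.lt_top_of_mul_ne_top_right ?_ hg0).ne
    rw [← hitSum_self_eq_mul hvb hcycle, h]
    exact ENNReal.one_ne_top
  have hyx : hitSum A v x b ≠ ∞ :=
    ne_top_of_le_ne_top
      (ENNReal.div_ne_top (ne_top_of_le_ne_top hf (hitSum_mono _ _ _ hxz))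
        (tsub_pos_of_lt hx).ne')
      (hitSum_le_div hvb (firstHit_ne_top hρ0 hy)
        (ne_top_of_le_ne_top (ne_top_of_hitSum_ne_top hg0z.ne' hg) hxz) hx)
  refine ⟨x, hρx, ?_⟩
  rw [hitSum_self_eq_mul hvb hcycle]
  exact ENNReal.mul_ne_top (ne_top_of_le_ne_top hg (hitSum_mono _ _ _ hxz)) hyx

end CyclesThroughBase

variable {G : Digraph V} {W : V → V → ℝ≥0}

lemma le_radius (h : genFun G W v z ≠ ∞) : z ≤ radius G W v :=
  le_sSup h.lt_top

theorem radius_eq_of_cycles_through (hvb : v ≠ b)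
    (hcycle : ∀ n, firstHit (avoiding (edgeWeight G W) b) v n v = 0)
    (h : genFun G W v (radius G W v) = 1) : radius G W b = radius G W v := by
  rw [genFun_eq_hitSum] at h
  refine le_antisymm (sSup_le fun z hz => ?_) (le_radius ?_)
  · by_contra! hlt
    rw [Set.mem_ofPred_eq, genFun_eq_hitSum] at hz
    obtain ⟨x, hx, hxtop⟩ := exists_gt_hitSum_self_ne_top hvb hcycle h hlt hz.ne
    exact hx.not_ge (le_radius (by rwa [genFun_eq_hitSum]))
  · rw [genFun_eq_hitSum, hitSum_base_eq_one hvb hcycle h]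
    exact ENNReal.one_ne_top

end Solidarity

section LinearGraph

variable {G : Digraph ℕ+} {W : ℕ+ → ℕ+ → ℝ≥0}

lemma IsLinear.lt_of_adj (hG : IsLinear G) {i j : ℕ+} (h : G.Adj i j) (hj : j ≠ 1) : i < j := by
  rcases hG.edge i j h with rfl | rfl | h
  · exact absurd rfl hj
  · exact PNat.lt_add_right i 1
  · exact (PNat.lt_add_right i 1).trans h

lemma IsLinear.firstHit_avoiding_one (hG : IsLinear G) {v i : ℕ+} (hi : v ≤ i) (n : ℕ) :
    firstHit (avoiding (edgeWeight G W) 1) v n i = 0 := by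
  have hdesc {i j : ℕ+} (hji : j ≤ i) : avoiding (edgeWeight G W) 1 i j = 0 := by
    rw [avoiding]
    split_ifs with hj
    · rfl
    · exact if_neg fun h => (hG.lt_of_adj h hj).not_ge hji
  induction n generalizing i with
  | zero => exact hdesc hi
  | succ n ih =>
    rw [firstHit, ENNReal.tsum_eq_zero]
    intro j
    split_ifs
    · rfl
    · rcases le_or_gt j i with hj | hj
      · rw [hdesc hj, zero_mul]
      · rw [ih (hi.trans hj.le), mul_zero]

theorem IsUnstablePositive.hitSum_hitDeriv_one (hG : IsLinear G) (h : IsUnstablePositive G W) :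
    hitSum (edgeWeight G W) 1 (radius G W 1) 1 = 1 ∧
      hitDeriv (edgeWeight G W) 1 (radius G W 1) 1 ≠ ∞ := by
  obtain ⟨v, hv, hv'⟩ := h
  have hsum := hv
  rw [genFun_eq_hitSum] at hsum
  have hderiv : hitDeriv (edgeWeight G W) v (radius G W v) v ≠ ∞ := by
    rw [← mul_genFunDeriv]
    exact ENNReal.mul_ne_top
      (ne_top_of_hitSum_ne_top (by rw [hsum]; exact one_ne_zero) (by rw [hsum]; simp)) hv'.ne
  obtain rfl | hv1 := eq_or_ne v 1
  · exact ⟨hsum, hderiv⟩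
  · have hcycle := hG.firstHit_avoiding_one (W := W) (le_refl v)
    rw [radius_eq_of_cycles_through hv1 hcycle hv]
    exact ⟨hitSum_base_eq_one hv1 hcycle hsum, hitDeriv_base_ne_top hv1 hcycle hsum hderiv⟩

end LinearGraph

/-! ### Subgraphs generated by cycles -/

section Comparison

variable {V : Type*} {A B : V → V → ℝ≥0∞} {v : V}

lemma edgeWeight_mono (W : V → V → ℝ≥0) : Monotone fun G : Digraph V => edgeWeight G W := by
  intro H G h i j
  by_cases hij : H.Adj i j
  · simp only [edgeWeight, if_pos hij, if_pos (h hij), le_refl]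
  · simp only [edgeWeight, if_neg hij, zero_le]

lemma edgeWeight_ne_zero {G : Digraph V} {W : V → V → ℝ≥0} (hW : ∀ i j, G.Adj i j → 0 < W i j)
    {i j : V} (h : G.Adj i j) : edgeWeight G W i j ≠ 0 := by
  rw [edgeWeight, if_pos h]
  exact ENNReal.coe_ne_zero.mpr (hW i j h).ne'

lemma edgeWeight_ne_top (G : Digraph V) (W : V → V → ℝ≥0) (i j : V) : edgeWeight G W i j ≠ ∞ := by
  rw [edgeWeight]
  split_ifs
  · exact ENNReal.coe_ne_top
  · exact ENNReal.zero_ne_top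

lemma firstHit_mono (h : B ≤ A) (n : ℕ) (i : V) : firstHit B v n i ≤ firstHit A v n i := by
  induction n generalizing i with
  | zero => exact h i v
  | succ n ih =>
    refine ENNReal.tsum_le_tsum fun j => ?_
    split_ifs
    · exact le_rfl
    · exact mul_le_mul' (h i j) (ih j)

lemma taboo_mono (h : B ≤ A) (n : ℕ) (j : V) : taboo B v n j ≤ taboo A v n j := by
  induction n generalizing j with
  | zero => exact le_rfl
  | succ n ih =>
    simp only [taboo]
    split_ifs
    · exact le_rfl
    · exact ENNReal.tsum_le_tsum fun i => mul_le_mul' (ih i) (h i j)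

variable {ι : Type*} {l : Filter ι} {B : ι → V → V → ℝ≥0∞}

lemma eventually_firstHit_eq (hB : ∀ i, ∀ᶠ n in l, B n i = A i)
    (hfin : ∀ i, {j | A i j ≠ 0}.Finite) (k : ℕ) (i : V) :
    ∀ᶠ n in l, firstHit (B n) v k i = firstHit A v k i := by
  induction k generalizing i with
  | zero => exact (hB i).mono fun n h => congrFun h v
  | succ k ih =>
    filter_upwards [hB i, (hfin i).eventually_all.mpr fun j _ => ih j] with n hrow hnext
    refine tsum_congr fun j => ?_
    by_cases hj : A i j = 0
    · simp only [hrow, hj, zero_mul]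
    · rw [hrow, hnext j hj]

lemma eventually_taboo_eq (hB : ∀ j ≠ v, ∀ᶠ n in l, ∀ i, B n i j = A i j)
    (hfin : ∀ j ≠ v, {i | A i j ≠ 0}.Finite) (k : ℕ) (j : V) :
    ∀ᶠ n in l, taboo (B n) v k j = taboo A v k j := by
  induction k generalizing j with
  | zero => exact Eventually.of_forall fun _ => rfl
  | succ k ih =>
    simp only [taboo]
    split_ifs with hj
    · exact Eventually.of_forall fun _ => rfl
    · filter_upwards [hB j hj, (hfin j hj).eventually_all.mpr fun i _ => ih i] with n hcol hprev
      refine tsum_congr fun i => ?_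
      by_cases hi : A i j = 0
      · simp only [hcol, hi, mul_zero]
      · rw [hcol, hprev i hi]

end Comparison

section CycleSubgraph

variable {V : Type*} {G : Digraph V} {W : V → V → ℝ≥0} {v a b : V} {k n : ℕ}

lemma cycleSubgraph_le (G : Digraph V) (v : V) (n : ℕ) : cycleSubgraph G v n ≤ G := by
  rintro a b ⟨l, -, x, hx, i, rfl, rfl⟩
  exact hx.2.2.2.1 i

lemma cycleSubgraph_mono (G : Digraph V) (v : V) : Monotone (cycleSubgraph G v) :=
  fun _ _ hmn _ _ ⟨l, hl, hx⟩ => ⟨l, hl.trans hmn, hx⟩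

lemma simpleCycles_cycleSubgraph (h : k ≤ n) :
    simpleCycles (cycleSubgraph G v n) v k = simpleCycles G v k := by
  ext x
  constructor
  · rintro ⟨hk, hfirst, hlast, hadj, hne⟩
    exact ⟨hk, hfirst, hlast, fun i => cycleSubgraph_le G v n (hadj i), hne⟩
  · intro hx
    exact ⟨hx.1, hx.2.1, hx.2.2.1, fun i => ⟨k, h, x, hx, i, rfl, rfl⟩, hx.2.2.2.2⟩

lemma firstHit_cycleSubgraph (h : k < n) :
    firstHit (edgeWeight (cycleSubgraph G v n) W) v k v = firstHit (edgeWeight G W) v k v := by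
  rw [← cycleSum_succ, ← cycleSum_succ, cycleSum, cycleSum,
    simpleCycles_cycleSubgraph (Nat.succ_le_of_lt h)]

lemma cycleSubgraph_adj_of_path {x : ℕ → V} (hkn : k < n) (hstart : x 0 = v)
    (hadj : ∀ i < k, G.Adj (x i) (x (i + 1))) (hne : ∀ i, i ≠ 0 → i ≤ k → x i ≠ v)
    (hback : G.Adj (x k) v) :
    (∀ i < k, (cycleSubgraph G v n).Adj (x i) (x (i + 1))) ∧
      (cycleSubgraph G v n).Adj (x k) v := by
  let y : Fin (k + 1 + 1) → V := Fin.snoc (fun i : Fin (k + 1) => x i) v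
  have hyx {i : ℕ} (hi : i < k + 1) : y ⟨i, hi.trans (Nat.lt_succ_self _)⟩ = x i :=
    Fin.snoc_castSucc (α := fun _ => V) v (fun i : Fin (k + 1) => x i) ⟨i, hi⟩
  have hyv : y (Fin.last (k + 1)) = v := Fin.snoc_last _ _
  have hy : y ∈ simpleCycles G v (k + 1) := by
    refine ⟨Nat.succ_pos k, (hyx (Nat.succ_pos k)).trans hstart, hyv, fun i => ?_,
      fun i hi hi' => ?_⟩
    · refine Fin.lastCases ?_ (fun i => ?_) i
      · rw [Fin.succ_last, hyv]
        exact (hyx (Nat.lt_succ_self k)).symm ▸ hback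
      · exact (hyx (i.castSucc.is_lt)).symm ▸ (hyx i.succ.is_lt).symm ▸ hadj i i.is_lt
    · have hik : (i : ℕ) < k + 1 := Fin.val_lt_last hi'
      exact (hyx hik).symm ▸ hne i (Fin.val_ne_zero_iff.mpr hi) (Nat.le_of_lt_succ hik)
  exact ⟨fun i hi => ⟨k + 1, hkn, y, hy, ⟨i, hi.trans (Nat.lt_succ_self k)⟩,
      hyx (hi.trans (Nat.lt_succ_self k)), hyx (Nat.succ_lt_succ hi)⟩,
    ⟨k + 1, hkn, y, hy, Fin.last k, hyx (Nat.lt_succ_self k), hyv⟩⟩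

lemma cycleSubgraph_adj_base (hback : G.Adj a v) (h : (cycleSubgraph G v n).Adj a b) :
    (cycleSubgraph G v n).Adj a v := by
  obtain ⟨l, hl, x, hx, i, rfl, rfl⟩ := h
  let y : ℕ → V := fun j => if hj : j < l + 1 then x ⟨j, hj⟩ else v
  have hy {j : ℕ} (hj : j < l + 1) : y j = x ⟨j, hj⟩ := dif_pos hj
  have hi : (i : ℕ) < l + 1 := i.castSucc.is_lt
  have hyi : y i = x i.castSucc := hy hi
  rw [← hyi] at hback ⊢
  refine (cycleSubgraph_adj_of_path (i.is_lt.trans_le hl) ((hy (Nat.succ_pos l)).trans hx.2.1)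
    (fun j hj => ?_) (fun j hj hji => ?_) hback).2
  · rw [hy (hj.trans hi), hy (Nat.succ_lt_succ (hj.trans i.is_lt))]
    exact hx.2.2.2.1 ⟨j, hj.trans i.is_lt⟩
  · rw [hy (hji.trans_lt hi)]
    exact hx.2.2.2.2 _ (Fin.val_ne_zero_iff.mp hj)
      (Fin.ne_of_lt (Fin.lt_def.mpr (hji.trans_lt i.is_lt)))

end CycleSubgraph

section LinearSubgraph

variable {G : Digraph ℕ+} {W : ℕ+ → ℕ+ → ℝ≥0} {K n : ℕ} {a b : ℕ+}

lemma IsLinear.cycleSubgraph_adj_one (hG : IsLinear G) (hn : (a : ℕ) ≤ n) :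
    (cycleSubgraph G 1 n).Adj a 1 := by
  have ha := a.natPred_add_one
  have hpath := (cycleSubgraph_adj_of_path (x := Nat.succPNat) (k := a.natPred) (n := n)
    (by omega) rfl (fun i _ => hG.step _)
    (fun i hi _ h => hi (Nat.succPNat_injective h)) (hG.backward _)).2
  rwa [PNat.succPNat_natPred] at hpath

lemma IsLinear.cycleSubgraph_adj (hG : IsLinear G) (h : G.Adj a b) (hn : (a : ℕ) < n) :
    (cycleSubgraph G 1 n).Adj a b := by
  obtain rfl | hb := eq_or_ne b 1
  · exact hG.cycleSubgraph_adj_one hn.le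
  · obtain ⟨m, rfl⟩ : ∃ m, a = Nat.succPNat m := ⟨a.natPred, a.succPNat_natPred.symm⟩
    let x : ℕ → ℕ+ := Function.update Nat.succPNat (m + 1) b
    have hx {i : ℕ} (hi : i < m + 1) : x i = i.succPNat := Function.update_of_ne hi.ne _ _
    have hxb : x (m + 1) = b := Function.update_self _ _ _
    have hpath := (cycleSubgraph_adj_of_path (k := m + 1) hn (hx (Nat.succ_pos m)) (fun i hi => ?_)
      (fun i hi hi' => ?_) (hG.backward _)).1 m (Nat.lt_succ_self m)
    · rwa [hx (Nat.lt_succ_self m), hxb] at hpath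
    · rcases Nat.lt_succ_iff_lt_or_eq.mp hi with hlt | rfl
      · rw [hx hi, hx (Nat.succ_lt_succ hlt)]
        exact hG.step _
      · rwa [hx hi, hxb]
    · rcases hi'.lt_or_eq with hlt | rfl
      · rw [hx hlt]
        exact fun h1 => hi (Nat.succPNat_injective h1)
      · exact hxb.symm ▸ hb

lemma HasBoundedJumps.exists_le_add (h : HasBoundedJumps G) :
    ∃ K : ℕ, ∀ i j, G.Adj i j → (j : ℕ) ≤ i + K := by
  obtain ⟨K, hK⟩ := h
  refine ⟨K, fun i j hij => ?_⟩
  rcases le_or_gt j i with hji | hlt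
  · exact le_add_right ((PNat.coe_le_coe _ _).mpr hji)
  · have hjump := hK i j hij hlt
    omega

lemma IsLinear.encard_outNeighbors_le (hG : IsLinear G)
    (hK : ∀ i j, G.Adj i j → (j : ℕ) ≤ i + K) (i : ℕ+) :
    {j | G.Adj i j}.encard ≤ (K + 2 : ℕ) := by
  have hsub : {j | G.Adj i j} ⊆ ↑(insert 1 (Finset.Ioc i (i + K.succPNat))) := fun j hj => by
    by_cases h1 : j = 1
    · simp [h1]
    · have hle := hK i j hj
      have hlt := hG.lt_of_adj hj h1
      simp only [Finset.coe_insert, Finset.coe_Ioc, Set.mem_insert_iff, Set.mem_Ioc]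
      refine Or.inr ⟨hlt, ?_⟩
      rw [← PNat.coe_le_coe, PNat.add_coe, Nat.succPNat_coe]
      omega
  refine (Set.encard_le_encard hsub).trans ?_
  rw [Set.encard_coe_eq_coe_finsetCard, Nat.cast_le]
  refine (Finset.card_insert_le _ _).trans (le_of_eq ?_)
  rw [PNat.card_Ioc, PNat.add_coe, Nat.succPNat_coe]
  omega

lemma le_of_cycleSubgraph_adj (hK : ∀ i j, G.Adj i j → (j : ℕ) ≤ i + K)
    (h : (cycleSubgraph G 1 n).Adj a b) : (a : ℕ) ≤ K * n + 1 := by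
  obtain ⟨l, hl, x, hx, i, rfl, rfl⟩ := h
  have hbound : ∀ j : Fin (l + 1), (x j : ℕ) ≤ K * j + 1 := fun j => by
    induction j using Fin.induction with
    | zero => simp [hx.2.1]
    | succ j ih =>
      refine (hK _ _ (hx.2.2.2.1 j)).trans ?_
      simp only [Fin.val_castSucc] at ih
      rw [Fin.val_succ, mul_add_one]
      omega
  refine (hbound _).trans (Nat.add_le_add_right (Nat.mul_le_mul_left K ?_) 1)
  exact i.castSucc.is_le.trans hl

lemma finite_edges_cycleSubgraph (hK : ∀ i j, G.Adj i j → (j : ℕ) ≤ i + K) (n : ℕ) :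
    {e : ℕ+ × ℕ+ | (cycleSubgraph G 1 n).Adj e.1 e.2}.Finite := by
  have hfin := Set.finite_Iic (K * n + K).succPNat
  refine (hfin.prod hfin).subset fun e he => ?_
  have hfst := le_of_cycleSubgraph_adj hK he
  have hsnd := hK _ _ (cycleSubgraph_le G 1 n he)
  constructor
  all_goals
    rw [Set.mem_Iic, ← PNat.coe_le_coe, Nat.succPNat_coe]
    omega

lemma IsLinear.isExhaustive_cycleSubgraph (hG : IsLinear G) :
    IsExhaustive G fun k => cycleSubgraph G 1 (k + 1) :=
  ⟨fun k _ _ h => cycleSubgraph_le G 1 (k + 1) h,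
    fun k _ _ h => cycleSubgraph_mono G 1 (k + 1).le_succ h,
    fun a _ h => ⟨a, hG.cycleSubgraph_adj h (Nat.lt_succ_self _)⟩,
    fun a => ⟨a, 1, Or.inl (hG.cycleSubgraph_adj_one (Nat.le_succ _))⟩⟩

lemma IsLinear.edgeWeight_cycleSubgraph (hG : IsLinear G) (h : G.Adj a b → (a : ℕ) < n) :
    edgeWeight (cycleSubgraph G 1 n) W a b = edgeWeight G W a b := by
  have hiff : (cycleSubgraph G 1 n).Adj a b ↔ G.Adj a b :=
    ⟨fun hab => cycleSubgraph_le G 1 n hab, fun hab => hG.cycleSubgraph_adj hab (h hab)⟩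
  rw [edgeWeight, edgeWeight, hiff]

lemma IsLinear.eventually_firstHit_cycleSubgraph (hG : IsLinear G) (k : ℕ) (i : ℕ+) :
    ∀ᶠ n in atTop, firstHit (edgeWeight (cycleSubgraph G 1 n) W) 1 k i =
      firstHit (edgeWeight G W) 1 k i := by
  refine eventually_firstHit_eq (fun i => ?_) (fun i => ?_) k i
  · filter_upwards [eventually_gt_atTop (i : ℕ)] with n hn
    exact funext fun j => hG.edgeWeight_cycleSubgraph fun _ => hn
  · refine ((hG.finite i).union (Set.toFinite {1, i + 1})).subset fun j hj => ?_
    have hadj := adj_of_edgeWeight_ne_zero hj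
    rcases hG.edge i j hadj with rfl | rfl | hjump
    · simp
    · simp
    · exact Or.inl ⟨hadj, hjump⟩

lemma IsLinear.eventually_taboo_cycleSubgraph (hG : IsLinear G) (k : ℕ) (j : ℕ+) :
    ∀ᶠ n in atTop, taboo (edgeWeight (cycleSubgraph G 1 n) W) 1 k j =
      taboo (edgeWeight G W) 1 k j := by
  refine eventually_taboo_eq (fun j hj => ?_) (fun j hj => ?_) k j
  · filter_upwards [eventually_ge_atTop (j : ℕ)] with n hn i
    exact hG.edgeWeight_cycleSubgraph fun hij =>
      ((PNat.coe_lt_coe _ _).mpr (hG.lt_of_adj hij hj)).trans_le hn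
  · exact (Set.finite_Iio j).subset fun i hi =>
      hG.lt_of_adj (adj_of_edgeWeight_ne_zero hi) hj

lemma IsLinear.add_le_of_firstHit_ne_zero (hG : IsLinear G)
    (hK : ∀ i j, G.Adj i j → (j : ℕ) ≤ i + K) {k : ℕ} {i : ℕ+}
    (h : firstHit (edgeWeight (cycleSubgraph G 1 n) W) 1 k i ≠ 0) :
    (i : ℕ) + k ≤ K * n + 1 := by
  induction k generalizing i with
  | zero => exact le_of_cycleSubgraph_adj hK (adj_of_edgeWeight_ne_zero h)
  | succ k ih =>
    rw [firstHit, Ne, ENNReal.tsum_eq_zero, not_forall] at h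
    obtain ⟨j, hj⟩ := h
    split_ifs at hj with hj1
    · exact absurd rfl hj
    · have hadj := cycleSubgraph_le G 1 n (adj_of_edgeWeight_ne_zero (left_ne_zero_of_mul hj))
      have hlt := hG.lt_of_adj hadj hj1
      have hle := ih (right_ne_zero_of_mul hj)
      rw [← PNat.coe_lt_coe] at hlt
      omega

lemma IsLinear.lt_of_taboo_ne_zero (hG : IsLinear G) {k : ℕ} {j : ℕ+}
    (h : taboo (edgeWeight G W) 1 k j ≠ 0) : k < j := by
  induction k generalizing j with
  | zero => exact j.pos
  | succ k ih =>
    rw [taboo] at h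
    split_ifs at h with hj1
    · exact absurd rfl h
    · rw [Ne, ENNReal.tsum_eq_zero, not_forall] at h
      obtain ⟨i, hi⟩ := h
      have hlt := hG.lt_of_adj (adj_of_edgeWeight_ne_zero (right_ne_zero_of_mul hi)) hj1
      exact (Nat.succ_le_of_lt (ih (left_ne_zero_of_mul hi))).trans_lt hlt

end LinearSubgraph

/-! ### Convergence of the finite approximations -/

section PowerSeries

lemma eventually_lt_tsum {ι κ : Type*} {l : Filter κ} {f : ι → ℝ≥0∞} {g : κ → ι → ℝ≥0∞} {c : ℝ≥0∞}
    (hc : c < ∑' i, f i) (h : ∀ i, ∀ᶠ n in l, f i ≤ g n i) : ∀ᶠ n in l, c < ∑' i, g n i := by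
  obtain ⟨s, hs⟩ := ((tendsto_order.mp ENNReal.summable.hasSum).1 c hc).exists
  filter_upwards [(Filter.eventually_all_finset s).mpr fun i _ => h i] with n hn
  exact hs.trans_le ((Finset.sum_le_sum hn).trans (ENNReal.sum_le_tsum s))

lemma tsum_mul_pow_le {a b : ℕ → ℝ≥0∞} {e : ℕ → ℕ} {r R : ℝ≥0∞} {L : ℕ} (hR0 : R ≠ 0)
    (hRtop : R ≠ ∞) (hr : R ≤ r) (hle : a ≤ b) (hvan : ∀ k, a k ≠ 0 → e k ≤ L) :
    ∑' k, a k * r ^ e k ≤ (r / R) ^ L * ∑' k, b k * R ^ e k := by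
  have hone : 1 ≤ r / R := by
    rwa [ENNReal.le_div_iff_mul_le (Or.inl hR0) (Or.inl hRtop), one_mul]
  rw [← ENNReal.tsum_mul_left]
  refine ENNReal.tsum_le_tsum fun k => ?_
  by_cases h0 : a k = 0
  · simp only [h0, zero_mul, zero_le]
  calc a k * r ^ e k = a k * ((r / R) ^ e k * R ^ e k) := by
        rw [← mul_pow, ENNReal.div_mul_cancel hR0 hRtop]
    _ ≤ b k * ((r / R) ^ L * R ^ e k) := by
        gcongr
        · exact hle k
        · exact hvan k h0
    _ = (r / R) ^ L * (b k * R ^ e k) := mul_left_comm _ _ _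

lemma tendsto_tsum_mul_pow {ι : Type*} {l : Filter ι} {a : ι → ℕ → ℝ≥0∞} {b : ℕ → ℝ≥0∞}
    {r : ι → ℝ≥0∞} {R : ℝ≥0∞} {e : ℕ → ℕ} {L : ι → ℕ} (hR0 : R ≠ 0) (hRtop : R ≠ ∞)
    (hr : ∀ᶠ n in l, R ≤ r n) (hlim : Tendsto (fun n => (r n / R) ^ L n) l (𝓝 1))
    (hle : ∀ n, a n ≤ b) (hev : ∀ k, ∀ᶠ n in l, a n k = b k)
    (hvan : ∀ᶠ n in l, ∀ k, a n k ≠ 0 → e k ≤ L n) :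
    Tendsto (fun n => ∑' k, a n k * r n ^ e k) l (𝓝 (∑' k, b k * R ^ e k)) := by
  refine tendsto_order.mpr ⟨fun c hc => eventually_lt_tsum hc fun k => ?_, fun c hc => ?_⟩
  · filter_upwards [hr, hev k] with n hrn hn
    rw [hn]
    gcongr
  · have hbound := ENNReal.Tendsto.mul_const (b := ∑' k, b k * R ^ e k) hlim
      (Or.inl one_ne_zero)
    rw [one_mul] at hbound
    filter_upwards [hr, hvan, (tendsto_order.mp hbound).2 c hc] with n hrn hvn hlt
    exact (tsum_mul_pow_le hR0 hRtop hrn (hle n) hvn).trans_lt hlt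

lemma one_le_pow_add_mul {x t : ℝ≥0∞} (hx : x ≤ 1) (h : 1 ≤ x + t) (n : ℕ) :
    1 ≤ x ^ n + n * t := by
  induction n with
  | zero => simp
  | succ n ih =>
    calc 1 ≤ x * 1 + t := by rwa [mul_one]
      _ ≤ x * (x ^ n + n * t) + t := by gcongr
      _ = x ^ (n + 1) + x * (n * t) + t := by ring
      _ ≤ x ^ (n + 1) + 1 * (n * t) + t := by gcongr
      _ = x ^ (n + 1) + (n + 1 : ℕ) * t := by
          push_cast
          ring

lemma tendsto_mul_tsum_add {f : ℕ → ℝ≥0∞} (hf : ∑' k, ((k + 1 : ℕ) : ℝ≥0∞) * f k ≠ ∞) (K : ℕ) :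
    Tendsto (fun n => ((K * n + 1 : ℕ) : ℝ≥0∞) * ∑' k, f (k + n)) atTop (𝓝 0) := by
  have htail := ENNReal.Tendsto.const_mul (a := (K + 1 : ℕ)) (ENNReal.tendsto_sum_nat_add _ hf)
    (Or.inr (ENNReal.natCast_ne_top _))
  rw [mul_zero] at htail
  refine tendsto_of_tendsto_of_tendsto_of_le_of_le tendsto_const_nhds htail (fun _ => zero_le)
    fun n => ?_
  simp only [← ENNReal.tsum_mul_left, ← mul_assoc]
  refine ENNReal.tsum_le_tsum fun k => ?_
  gcongr
  rw [← Nat.cast_mul, Nat.cast_le]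
  nlinarith [Nat.zero_le (K * k), Nat.zero_le k]

end PowerSeries

section Roots

variable {V : Type*} {A B : V → V → ℝ≥0∞} {v : V} {R r : ℝ≥0∞}

lemma hitSum_mul_le (A : V → V → ℝ≥0∞) (v i : V) {c : ℝ≥0∞} (hc : c ≤ 1) (z : ℝ≥0∞) :
    hitSum A v (c * z) i ≤ c * hitSum A v z i := by
  simp only [hitSum, ← ENNReal.tsum_mul_left]
  refine ENNReal.tsum_le_tsum fun n => ?_
  rw [mul_pow, mul_left_comm]
  gcongr
  exact pow_le_of_le_one zero_le hc n.succ_ne_zero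

lemma hitSum_le_of_le (h : B ≤ A) (z : ℝ≥0∞) (i : V) : hitSum B v z i ≤ hitSum A v z i :=
  ENNReal.tsum_le_tsum fun n => mul_le_mul_left (firstHit_mono h n i) _

lemma ne_top_of_hitSum_eq_one (h : hitSum A v r v = 1) : r ≠ ∞ :=
  ne_top_of_hitSum_ne_top (h ▸ one_ne_zero) (h ▸ ENNReal.one_ne_top)

lemma le_of_hitSum_eq_one (hBA : B ≤ A) (hR : hitSum A v R v = 1) (hr : hitSum B v r v = 1) :
    R ≤ r := by
  by_contra! hlt
  have hR0 := ne_zero_of_hitSum_eq_one hR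
  have hRtop := ne_top_of_hitSum_eq_one hR
  have hdiv : r / R < 1 := by
    rwa [ENNReal.div_lt_iff (Or.inl hR0) (Or.inl hRtop), one_mul]
  refine lt_irrefl (1 : ℝ≥0∞) ?_
  calc 1 = hitSum B v (r / R * R) v := by rw [ENNReal.div_mul_cancel hR0 hRtop, hr]
    _ ≤ r / R * hitSum B v R v := hitSum_mul_le B v v hdiv.le R
    _ ≤ r / R * 1 := by
        gcongr
        exact hR ▸ hitSum_le_of_le hBA R v
    _ < 1 := by rwa [mul_one]

lemma one_le_div_add_tsum {n : ℕ} (hBA : B ≤ A) (hR : hitSum A v R v = 1)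
    (hr : hitSum B v r v = 1) (heq : ∀ k < n, firstHit B v k v = firstHit A v k v) :
    1 ≤ R / r + ∑' k, firstHit A v (k + n) v * R ^ (k + n + 1) := by
  have hr0 := ne_zero_of_hitSum_eq_one hr
  have hrtop := ne_top_of_hitSum_eq_one hr
  have hdiv : R / r ≤ 1 := ENNReal.div_le_of_le_mul (by
    rw [one_mul]
    exact le_of_hitSum_eq_one hBA hR hr)
  calc 1 = ∑ k ∈ Finset.range n, firstHit A v k v * R ^ (k + 1) +
        ∑' k, firstHit A v (k + n) v * R ^ (k + n + 1) := by
        rw [← hR, hitSum, ENNReal.summable.sum_add_tsum_nat_add' (k := n)]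
    _ ≤ hitSum B v R v + ∑' k, firstHit A v (k + n) v * R ^ (k + n + 1) := by
        gcongr
        rw [Finset.sum_congr rfl fun k hk => by rw [← heq k (Finset.mem_range.mp hk)]]
        exact ENNReal.sum_le_tsum _
    _ ≤ R / r + ∑' k, firstHit A v (k + n) v * R ^ (k + n + 1) := by
        gcongr
        have hmul := hitSum_mul_le B v v hdiv r
        rwa [ENNReal.div_mul_cancel hr0 hrtop, hr, mul_one] at hmul

lemma tendsto_div_pow {B : ℕ → V → V → ℝ≥0∞} {r : ℕ → ℝ≥0∞} (hBA : ∀ n, B n ≤ A)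
    (heq : ∀ n, ∀ k < n, firstHit (B n) v k v = firstHit A v k v)
    (hR : hitSum A v R v = 1) (hD : hitDeriv A v R v ≠ ∞)
    (hr : ∀ᶠ n in atTop, hitSum (B n) v (r n) v = 1) (K : ℕ) :
    Tendsto (fun n => (r n / R) ^ (K * n + 1)) atTop (𝓝 1) := by
  have hinv : Tendsto (fun n => (R / r n) ^ (K * n + 1)) atTop (𝓝 1) := by
    have htail := ENNReal.Tendsto.sub (tendsto_const_nhds (x := 1)) (tendsto_mul_tsum_add hD K)
      (Or.inl ENNReal.one_ne_top)
    rw [tsub_zero] at htail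
    refine tendsto_of_tendsto_of_tendsto_of_le_of_le' htail tendsto_const_nhds ?_ ?_
    all_goals
      filter_upwards [hr] with n hn
      have hdiv : R / r n ≤ 1 := ENNReal.div_le_of_le_mul (by
        rw [one_mul]
        exact le_of_hitSum_eq_one (hBA n) hR hn)
    · exact tsub_le_iff_right.mpr
        (one_le_pow_add_mul hdiv (one_le_div_add_tsum (hBA n) hR hn (heq n)) _)
    · exact pow_le_one₀ zero_le hdiv
  have hR0 := ne_zero_of_hitSum_eq_one hR
  have hRtop := ne_top_of_hitSum_eq_one hR
  refine tendsto_inv_iff.mp ?_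
  simp_rw [inv_one, ENNReal.inv_pow, ENNReal.inv_div (Or.inl hRtop) (Or.inl hR0)]
  exact hinv

lemma exists_hitSum_eq_one {M : ℕ} (hM : ∀ k, M ≤ k → firstHit A v k v = 0)
    (htop : ∀ k, firstHit A v k v ≠ ∞) (h0 : ∃ k, firstHit A v k v ≠ 0) :
    ∃ z, hitSum A v z v = 1 := by
  have hsum (z : ℝ≥0∞) :
      hitSum A v z v = ∑ k ∈ Finset.range M, firstHit A v k v * z ^ (k + 1) :=
    tsum_eq_sum fun k hk => by rw [hM k (by simpa using hk), zero_mul]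
  have hcont : Continuous fun z => hitSum A v z v := by
    simp only [hsum]
    exact continuous_finsetSum _ fun k _ =>
      (ENNReal.continuous_const_mul (htop k)).comp (ENNReal.continuous_pow (k + 1))
  refine mem_range_of_exists_le_of_exists_ge hcont ⟨0, ?_⟩ ⟨∞, ?_⟩
  · simp [hitSum]
  · by_contra! hlt
    exact ne_top_of_hitSum_ne_top ((hitSum_ne_zero_iff ENNReal.top_ne_zero).mpr h0)
      (hlt.trans ENNReal.one_lt_top).ne rfl

lemma IsPositiveRecurrent.of_firstHit_eq_zero {M : ℕ} (h : hitSum A v r v = 1)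
    (hM : ∀ k i, M ≤ k → firstHit A v k i = 0) (htop : ∀ k i, firstHit A v k i ≠ ∞) :
    IsPositiveRecurrent A v r := by
  have hterm (k : ℕ) (i : V) : firstHit A v k i * r ^ (k + 1) ≠ ∞ :=
    ENNReal.mul_ne_top (htop k i) (ENNReal.pow_ne_top (ne_top_of_hitSum_eq_one h))
  refine ⟨h, fun i => ?_, ?_⟩
  · rw [hitSum, tsum_eq_sum (s := Finset.range M)
      fun k hk => by rw [hM k i (by simpa using hk), zero_mul]]
    exact ENNReal.sum_ne_top.mpr fun k _ => hterm k i
  · rw [hitDeriv, tsum_eq_sum (s := Finset.range M)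
      fun k hk => by rw [hM k v (by simpa using hk), zero_mul, mul_zero]]
    exact ENNReal.sum_ne_top.mpr fun k _ =>
      ENNReal.mul_ne_top (ENNReal.natCast_ne_top _) (hterm k v)

lemma IsPositiveRecurrent.tabooSum_ne_top (hA : IsPositiveRecurrent A v r) {j : V}
    (hj : hitSum A v r j ≠ 0) : tabooSum A v r j ≠ ∞ :=
  (ENNReal.lt_top_of_mul_ne_top_left (ENNReal.ne_top_of_tsum_ne_top hA.tsum_ne_top j) hj).ne

lemma IsPositiveRecurrent.firstHit_ne_top_of_le (hA : IsPositiveRecurrent A v r) (hBA : B ≤ A)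
    (k : ℕ) (i : V) : firstHit B v k i ≠ ∞ :=
  ne_top_of_le_ne_top
    (firstHit_ne_top (ne_zero_of_hitSum_eq_one hA.hitSum_self) (hA.hitSum_ne_top i) k)
    (firstHit_mono hBA k i)

lemma IsPositiveRecurrent.hitSum_ne_zero_of_adj {G : Digraph V} {W : V → V → ℝ≥0}
    (hA : IsPositiveRecurrent (edgeWeight G W) v r) (hW : ∀ i j, G.Adj i j → 0 < W i j) {i : V}
    (h : G.Adj i v) : hitSum (edgeWeight G W) v r i ≠ 0 :=
  (hitSum_ne_zero_iff (ne_zero_of_hitSum_eq_one hA.hitSum_self)).mpr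
    ⟨0, edgeWeight_ne_zero hW h⟩

lemma IsPositiveRecurrent.hitDeriv_ne_zero (hA : IsPositiveRecurrent A v r) :
    hitDeriv A v r v ≠ 0 := by
  rw [← tsum_tabooSum_mul_hitSum]
  exact hA.tsum_ne_zero

end Roots

section EquilibriumLimit

variable {V : Type*} [MeasurableSpace V] [Countable V] [DiscreteMeasurableSpace V]
  [TopologicalSpace V] [DiscreteTopology V] [OpensMeasurableSpace (ℤ → V)]
  {A : V → V → ℝ≥0∞} {B : ℕ → V → V → ℝ≥0∞} {v : V} {R : ℝ≥0∞} {r : ℕ → ℝ≥0∞}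

lemma IsPositiveRecurrent.tendsto_equilibrium (hA : IsPositiveRecurrent A v R)
    (hB : ∀ n, IsPositiveRecurrent (B n) v (r n)) (hAtop : ∀ i j, A i j ≠ ∞)
    (hpos : ∀ i, hitSum A v R i ≠ 0) (hr : Tendsto r atTop (𝓝 R))
    (hBA : ∀ i j, Tendsto (fun n => B n i j) atTop (𝓝 (A i j)))
    (hhit : ∀ i, Tendsto (fun n => hitSum (B n) v (r n) i) atTop (𝓝 (hitSum A v R i)))
    (htaboo : ∀ j, Tendsto (fun n => tabooSum (B n) v (r n) j) atTop (𝓝 (tabooSum A v R j)))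
    (hderiv : Tendsto (fun n => hitDeriv (B n) v (r n) v) atTop (𝓝 (hitDeriv A v R v))) :
    Tendsto (fun n => (hB n).equilibrium) atTop (𝓝 hA.equilibrium) := by
  have hRtop := ne_top_of_hitSum_eq_one hA.hitSum_self
  have htop (i j : V) : R * A i j ≠ ∞ := ENNReal.mul_ne_top hRtop (hAtop i j)
  have hstep (i j : V) : Tendsto (fun n => r n * B n i j) atTop (𝓝 (R * A i j)) :=
    ENNReal.Tendsto.mul hr (Or.inr (hAtop i j)) (hBA i j) (Or.inr hRtop)
  refine tendsto_of_tendsto_cylinder hA.measurePreserving_equilibrium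
    (fun n => (hB n).measurePreserving_equilibrium) fun m w => ?_
  simp only [equilibrium_cylinder]
  have hprod : ∏ i : Fin m, R * A (w i.castSucc) (w i.succ) ≠ ∞ :=
    ENNReal.prod_ne_top fun i _ => htop _ _
  have htw := hA.tabooSum_ne_top (hpos (w 0))
  have hhw := hA.hitSum_ne_top (w (Fin.last m))
  refine ENNReal.Tendsto.div (ENNReal.Tendsto.mul (ENNReal.Tendsto.mul (htaboo _) (Or.inr hprod)
    (ENNReal.tendsto_finsetProd_of_ne_top _ (fun i _ => hstep _ _) fun i _ => htop _ _)
    (Or.inr htw)) (Or.inr hhw) (hhit _) (Or.inr (ENNReal.mul_ne_top htw hprod)))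
    (Or.inr hA.hitDeriv_ne_zero) hderiv
    (Or.inr (ENNReal.mul_ne_top (ENNReal.mul_ne_top htw hprod) hhw))

end EquilibriumLimit

section CycleSubgraphLimit

variable {V : Type*} {G : Digraph V} {W : V → V → ℝ≥0} {v : V} {K : ℕ} {R : ℝ≥0∞} {r : ℕ → ℝ≥0∞}
  (hA : IsPositiveRecurrent (edgeWeight G W) v R)
  (hr : ∀ᶠ n in atTop, hitSum (edgeWeight (cycleSubgraph G v n) W) v (r n) v = 1)
include hA hr

lemma tendsto_root_div_pow (K : ℕ) : Tendsto (fun n => (r n / R) ^ (K * n + 1)) atTop (𝓝 1) :=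
  tendsto_div_pow (fun n => edgeWeight_mono W (cycleSubgraph_le G v n))
    (fun _ _ hk => firstHit_cycleSubgraph hk) hA.hitSum_self hA.hitDeriv_ne_top hr K

lemma tendsto_root : Tendsto r atTop (𝓝 R) := by
  have hlim := ENNReal.Tendsto.mul_const (b := R) (tendsto_root_div_pow hA hr 0)
    (Or.inl one_ne_zero)
  simpa only [zero_mul, zero_add, pow_one, one_mul, ENNReal.div_mul_cancel
    (ne_zero_of_hitSum_eq_one hA.hitSum_self) (ne_top_of_hitSum_eq_one hA.hitSum_self)] using hlim

lemma tendsto_tsum_mul_root_pow {a : ℕ → ℕ → ℝ≥0∞} {b : ℕ → ℝ≥0∞} {e : ℕ → ℕ} (hle : ∀ n, a n ≤ b)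
    (hev : ∀ k, ∀ᶠ n in atTop, a n k = b k)
    (hvan : ∀ᶠ n in atTop, ∀ k, a n k ≠ 0 → e k ≤ K * n + 1) :
    Tendsto (fun n => ∑' k, a n k * r n ^ e k) atTop (𝓝 (∑' k, b k * R ^ e k)) :=
  tendsto_tsum_mul_pow (ne_zero_of_hitSum_eq_one hA.hitSum_self)
    (ne_top_of_hitSum_eq_one hA.hitSum_self)
    (hr.mono fun n hn =>
      le_of_hitSum_eq_one (edgeWeight_mono W (cycleSubgraph_le G v n)) hA.hitSum_self hn)
    (tendsto_root_div_pow hA hr K) hle hev hvan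

end CycleSubgraphLimit

section LinearRoots

variable {G : Digraph ℕ+} {W : ℕ+ → ℕ+ → ℝ≥0} {K n : ℕ} {R z : ℝ≥0∞}

lemma IsLinear.isPositiveRecurrent (hG : IsLinear G) (hW : ∀ i j, G.Adj i j → 0 < W i j)
    (hR : hitSum (edgeWeight G W) 1 R 1 = 1) (hD : hitDeriv (edgeWeight G W) 1 R 1 ≠ ∞) :
    IsPositiveRecurrent (edgeWeight G W) 1 R := by
  refine ⟨hR, fun i => ?_, hD⟩
  induction i using PNat.recOn with
  | one => exact hR ▸ ENNReal.one_ne_top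
  | succ i ih =>
    have hterm := ENNReal.ne_top_of_tsum_ne_top (hitSum_eq_tsum_of_eq_one hR i ▸ ih) (i + 1)
    exact (ENNReal.lt_top_of_mul_ne_top_right hterm (mul_ne_zero (ne_zero_of_hitSum_eq_one hR)
      (edgeWeight_ne_zero hW (hG.step i)))).ne

lemma IsLinear.firstHit_cycleSubgraph_eq_zero (hG : IsLinear G)
    (hK : ∀ i j, G.Adj i j → (j : ℕ) ≤ i + K) {k : ℕ} (hk : K * n + 1 ≤ k) (i : ℕ+) :
    firstHit (edgeWeight (cycleSubgraph G 1 n) W) 1 k i = 0 := by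
  by_contra h
  have hle := hG.add_le_of_firstHit_ne_zero hK h
  have hpos := i.pos
  omega

lemma IsLinear.existsUnique_genFun_cycleSubgraph_eq_one (hG : IsLinear G)
    (hK : ∀ i j, G.Adj i j → (j : ℕ) ≤ i + K) (hW : ∀ i j, G.Adj i j → 0 < W i j)
    (hA : IsPositiveRecurrent (edgeWeight G W) 1 R) (hn : 1 ≤ n) :
    ∃! r : ℝ≥0, genFun (cycleSubgraph G 1 n) W 1 r = 1 := by
  have hloop : edgeWeight (cycleSubgraph G 1 n) W 1 1 ≠ 0 :=
    edgeWeight_ne_zero (fun i j h => hW i j (cycleSubgraph_le G 1 n h))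
      (hG.cycleSubgraph_adj_one hn)
  obtain ⟨z, hz⟩ := exists_hitSum_eq_one
    (fun k hk => hG.firstHit_cycleSubgraph_eq_zero hK hk 1)
    (fun k => hA.firstHit_ne_top_of_le (edgeWeight_mono W (cycleSubgraph_le G 1 n)) k 1) ⟨0, hloop⟩
  lift z to ℝ≥0 using ne_top_of_hitSum_eq_one hz
  simp only [genFun_eq_hitSum]
  exact ⟨z, hz, fun y hy => ENNReal.coe_injective
    (le_antisymm (le_of_hitSum_eq_one le_rfl hy hz) (le_of_hitSum_eq_one le_rfl hz hy))⟩

lemma IsLinear.isPositiveRecurrent_cycleSubgraph (hG : IsLinear G)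
    (hK : ∀ i j, G.Adj i j → (j : ℕ) ≤ i + K) (hA : IsPositiveRecurrent (edgeWeight G W) 1 R)
    (hz : genFun (cycleSubgraph G 1 n) W 1 z = 1) :
    IsPositiveRecurrent (edgeWeight (cycleSubgraph G 1 n) W) 1 z :=
  .of_firstHit_eq_zero (genFun_eq_hitSum _ W 1 z ▸ hz)
    (fun _ i hk => hG.firstHit_cycleSubgraph_eq_zero hK hk i)
    (hA.firstHit_ne_top_of_le (edgeWeight_mono W (cycleSubgraph_le G 1 n)))

lemma IsLinear.isEquilibriumMeasure_iff (hG : IsLinear G)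
    (hK : ∀ i j, G.Adj i j → (j : ℕ) ≤ i + K) (hW : ∀ i j, G.Adj i j → 0 < W i j)
    (hA : IsPositiveRecurrent (edgeWeight G W) 1 R) {ν : ProbabilityMeasure (ℤ → ℕ+)} :
    IsEquilibriumMeasure G W ν ↔ ν = hA.equilibrium :=
  hA.isEquilibriumMeasure_iff hW (fun i _ _ => hA.hitSum_ne_zero_of_adj hW (hG.backward i))
    (hG.encard_outNeighbors_le hK)

lemma IsLinear.isEquilibriumMeasure_cycleSubgraph_iff (hG : IsLinear G)
    (hK : ∀ i j, G.Adj i j → (j : ℕ) ≤ i + K) (hW : ∀ i j, G.Adj i j → 0 < W i j)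
    (hA : IsPositiveRecurrent (edgeWeight (cycleSubgraph G 1 n) W) 1 z)
    {ν : ProbabilityMeasure (ℤ → ℕ+)} :
    IsEquilibriumMeasure (cycleSubgraph G 1 n) W ν ↔ ν = hA.equilibrium := by
  have hW' : ∀ i j, (cycleSubgraph G 1 n).Adj i j → 0 < W i j := fun i j h =>
    hW i j (cycleSubgraph_le G 1 n h)
  exact hA.isEquilibriumMeasure_iff hW'
    (fun i _ h => hA.hitSum_ne_zero_of_adj hW' (cycleSubgraph_adj_base (hG.backward i) h))
    fun i => (Set.encard_le_encard fun _ h => cycleSubgraph_le G 1 n h).trans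
      (hG.encard_outNeighbors_le hK i)

end LinearRoots

section LinearLimit

variable {G : Digraph ℕ+} {W : ℕ+ → ℕ+ → ℝ≥0} {K : ℕ} {R : ℝ≥0∞} {r : ℕ → ℝ≥0∞}

lemma IsLinear.tendsto_edgeWeight_cycleSubgraph (hG : IsLinear G) (i j : ℕ+) :
    Tendsto (fun n => edgeWeight (cycleSubgraph G 1 n) W i j) atTop (𝓝 (edgeWeight G W i j)) :=
  tendsto_const_nhds.congr' ((eventually_gt_atTop (i : ℕ)).mono fun _ hn =>
    (hG.edgeWeight_cycleSubgraph fun _ => hn).symm)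

section Root

variable (hG : IsLinear G) (hA : IsPositiveRecurrent (edgeWeight G W) 1 R)
  (hr : ∀ᶠ n in atTop, hitSum (edgeWeight (cycleSubgraph G 1 n) W) 1 (r n) 1 = 1)
include hG hA hr

lemma IsLinear.tendsto_hitSum_cycleSubgraph (hK : ∀ i j, G.Adj i j → (j : ℕ) ≤ i + K) (i : ℕ+) :
    Tendsto (fun n => hitSum (edgeWeight (cycleSubgraph G 1 n) W) 1 (r n) i) atTop
      (𝓝 (hitSum (edgeWeight G W) 1 R i)) := by
  refine tendsto_tsum_mul_root_pow hA hr (K := K) (e := fun k => k + 1)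
    (fun n k => firstHit_mono (edgeWeight_mono W (cycleSubgraph_le G 1 n)) k i)
    (fun k => hG.eventually_firstHit_cycleSubgraph k i) (.of_forall fun n k hk => ?_)
  have hle := hG.add_le_of_firstHit_ne_zero hK hk
  have hpos := i.pos
  omega

lemma IsLinear.tendsto_genFunDeriv_cycleSubgraph (hK : ∀ i j, G.Adj i j → (j : ℕ) ≤ i + K) :
    Tendsto (fun n => genFunDeriv (cycleSubgraph G 1 n) W 1 (r n)) atTop
      (𝓝 (genFunDeriv G W 1 R)) := by
  simp only [genFunDeriv_eq]
  refine tendsto_tsum_mul_root_pow hA hr (K := K) (e := fun k => k) (fun n k => ?_) (fun k => ?_)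
    (.of_forall fun n k hk => ?_)
  · gcongr
    exact firstHit_mono (edgeWeight_mono W (cycleSubgraph_le G 1 n)) k 1
  · filter_upwards [hG.eventually_firstHit_cycleSubgraph (W := W) k 1] with n hn
    rw [hn]
  · exact le_of_add_le_right (hG.add_le_of_firstHit_ne_zero hK (right_ne_zero_of_mul hk))

lemma IsLinear.tendsto_tabooSum_cycleSubgraph (j : ℕ+) :
    Tendsto (fun n => tabooSum (edgeWeight (cycleSubgraph G 1 n) W) 1 (r n) j) atTop
      (𝓝 (tabooSum (edgeWeight G W) 1 R j)) := by
  have hmono (n k : ℕ) := taboo_mono (v := 1)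
    (edgeWeight_mono W (cycleSubgraph_le G 1 n)) k j
  refine tendsto_tsum_mul_root_pow hA hr (K := 1) (e := fun k => k) hmono
    (fun k => hG.eventually_taboo_cycleSubgraph k j) ?_
  filter_upwards [eventually_ge_atTop (j : ℕ)] with n hn k hk
  have hlt := hG.lt_of_taboo_ne_zero (ne_bot_of_le_ne_bot hk (hmono n k))
  omega

lemma IsLinear.tendsto_hitDeriv_cycleSubgraph (hK : ∀ i j, G.Adj i j → (j : ℕ) ≤ i + K) :
    Tendsto (fun n => hitDeriv (edgeWeight (cycleSubgraph G 1 n) W) 1 (r n) 1) atTop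
      (𝓝 (hitDeriv (edgeWeight G W) 1 R 1)) := by
  have hD := hA.hitDeriv_ne_top
  simp only [← mul_genFunDeriv] at hD ⊢
  exact ENNReal.Tendsto.mul (tendsto_root hA hr)
    (Or.inr (ENNReal.lt_top_of_mul_ne_top_right hD (ne_zero_of_hitSum_eq_one hA.hitSum_self)).ne)
    (hG.tendsto_genFunDeriv_cycleSubgraph hA hr hK)
    (Or.inr (ne_top_of_hitSum_eq_one hA.hitSum_self))

end Root

lemma IsLinear.isRegularSequence_cycleSubgraph (hG : IsLinear G)
    (hK : ∀ i j, G.Adj i j → (j : ℕ) ≤ i + K) (hW : ∀ i j, G.Adj i j → 0 < W i j)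
    (hA : IsPositiveRecurrent (edgeWeight G W) 1 R) :
    IsRegularSequence G W fun k => cycleSubgraph G 1 (k + 1) := by
  choose! r hr _ using fun n => hG.existsUnique_genFun_cycleSubgraph_eq_one (n := n) hK hW hA
  have hB (k : ℕ) := hG.isPositiveRecurrent_cycleSubgraph hK hA (hr (k + 1) (Nat.le_add_left 1 k))
  have hμ {ν} := hG.isEquilibriumMeasure_iff hK hW hA (ν := ν)
  have hμs {k ν} := hG.isEquilibriumMeasure_cycleSubgraph_iff hK hW (hB k) (ν := ν)
  refine ⟨hG.isExhaustive_cycleSubgraph, fun k => finite_edges_cycleSubgraph hK (k + 1),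
    ⟨_, hμ.mpr rfl, fun _ => hμ.mp⟩, fun k => ⟨_, hμs.mpr rfl, fun _ => hμs.mp⟩,
    fun ν νs hν hνs => ?_⟩
  obtain rfl := hμ.mp hν
  obtain rfl : νs = fun k => (hB k).equilibrium := funext fun k => hμs.mp (hνs k)
  have hroot : ∀ᶠ n in atTop, hitSum (edgeWeight (cycleSubgraph G 1 n) W) 1 (r n) 1 = 1 := by
    filter_upwards [eventually_ge_atTop 1] with n hn
    rw [← genFun_eq_hitSum, hr n hn]
  have hshift := tendsto_add_atTop_nat 1
  exact hA.tendsto_equilibrium hB (edgeWeight_ne_top G W)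
    (fun i => hA.hitSum_ne_zero_of_adj hW (hG.backward i)) ((tendsto_root hA hroot).comp hshift)
    (fun i j => (hG.tendsto_edgeWeight_cycleSubgraph i j).comp hshift)
    (fun i => (hG.tendsto_hitSum_cycleSubgraph hA hroot hK i).comp hshift)
    (fun j => (hG.tendsto_tabooSum_cycleSubgraph hA hroot j).comp hshift)
    ((hG.tendsto_hitDeriv_cycleSubgraph hA hroot hK).comp hshift)

end LinearLimit

end

end LoadedGraph

theorem theorem2 (G : Digraph ℕ+) (hlin : LoadedGraph.IsLinear G)
    (hjumps : LoadedGraph.HasBoundedJumps G)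
    (W : ℕ+ → ℕ+ → ℝ≥0) (hW : ∀ i j, G.Adj i j → 0 < W i j)
    (hup : LoadedGraph.IsUnstablePositive G W) :
    LoadedGraph.IsRegularSequence G W (fun k => LoadedGraph.cycleSubgraph G 1 (k + 1)) ∧
    (∀ n : ℕ, 1 ≤ n →
      ∃! r : ℝ≥0, LoadedGraph.genFun (LoadedGraph.cycleSubgraph G 1 n) W 1 r = 1) ∧
    ∀ r : ℕ → ℝ≥0,
      (∀ n : ℕ, 1 ≤ n →
        LoadedGraph.genFun (LoadedGraph.cycleSubgraph G 1 n) W 1 (r n) = 1) →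
      Tendsto
        (fun n => LoadedGraph.genFunDeriv (LoadedGraph.cycleSubgraph G 1 n) W 1 (r n)) atTop
        (𝓝 (LoadedGraph.genFunDeriv G W 1 (LoadedGraph.radius G W 1))) := by
  obtain ⟨K, hK⟩ := hjumps.exists_le_add
  obtain ⟨hR, hD⟩ := hup.hitSum_hitDeriv_one hlin
  have hA := hlin.isPositiveRecurrent hW hR hD
  refine ⟨hlin.isRegularSequence_cycleSubgraph hK hW hA,
    fun n hn => hlin.existsUnique_genFun_cycleSubgraph_eq_one hK hW hA hn,
    fun r hr => hlin.tendsto_genFunDeriv_cycleSubgraph hA ?_ hK⟩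
  filter_upwards [eventually_ge_atTop 1] with n hn
  rw [← LoadedGraph.genFun_eq_hitSum, hr n hn]
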